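/- Let $(\mathbf{x},\mathbf{y},\mathbf{z})$ be a jointly Gaussian triple of random vectors with values in $\mathbb{R}^{n_x},\mathbb{R}^{n_y},\mathbb{R}^{n_z}$, of arbitrary dimensions. Let $\Sigma_{x|z}$ and $\Sigma_{x|yz}$ be the conditional covariance matrices of $\mathbf{x}$ given $\mathbf{z}$ and given $(\mathbf{y},\mathbf{z})$, i.e. the covariance matrices of the estimation errors $\mathbf{x}-E[\mathbf{x}|\mathbf{z}]$ and $\mathbf{x}-E[\mathbf{x}|\mathbf{y},\mathbf{z}]$. For a symmetric $n_x\times n_x$ matrix $D$, define the rate-distortion function $$R(D)=\inf_{\mathbf{u}}\, I(\mathbf{y};\mathbf{u}\,|\,\mathbf{z})\quad\text{subject to}\quad E\big[(\mathbf{x}-\hat{\mathbf{x}})(\mathbf{x}-\hat{\mathbf{x}})^T\big]\preceq D,\qquad \hat{\mathbf{x}}=E[\mathbf{x}\,|\,\mathbf{u},\mathbf{z}],$$ where $\mathbf{u}$ ranges over all random variables (with values in any standard Borel space, possibly using extra randomness) such that $\mathbf{u}\leftrightarrow\mathbf{y}\leftrightarrow(\mathbf{x},\mathbf{z})$ is a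 Markov chain, and $\log$ and $I$ are in nats. Suppose $\Sigma_{x|yz}\prec D\preceq\Sigma_{x|z}$. Then $$R(D)=\frac12\log\left(\frac{|\Sigma_{x|z}-\Sigma_{x|yz}|}{|D-\Sigma_{x|yz}|}\right),$$ this is a nonnegative real number, and the infimum is a minimum, attained by some admissible $\mathbf{u}$ whose reconstruction error covariance $E[(\mathbf{x}-\hat{\mathbf{x}})(\mathbf{x}-\hat{\mathbf{x}})^T]$ is equal to $D$. Moreover, put $\Sigma_1=\Sigma_{x|z}-\Sigma_{x|yz}$ and $\Sigma_2=D-\Sigma_{x|yz}$, and call a nonsingular $V$ a joint diagonalizer of $\Sigma_1,\Sigma_2$ if $V\Sigma_1V^T=\mathrm{diag}(\lambda_1,\dots,\lambda_{n_x})$, where $\lambda_1,\dots,\lambda_{n_x}$ are the eigenvalues of $\Sigma_1$, and $V\Sigma_2V^T=\mathrm{diag}(\lambda'_1,\dots,\lambda'_{n_x})$. Joint diagonalizers exist, and for every one of them the lower bound $\frac12\sum_i\log\max\big(\lambda_{(i)}/\lambda'_{(i)},1\big)$ (with both sequences sorted by magnitude) and the upper bound $\frac12\sum_i\log\max\big(\lambda_i/\lambda'_i,1\big)$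 coincide, both being equal to the expression for $R(D)$ above. -/

import Mathlib

open MeasureTheory ProbabilityTheory
open scoped ENNReal Matrix

noncomputable section

namespace RemoteSource

/-- The space `ℝⁿ` of real vectors of length `n`. -/
abbrev Vec (n : ℕ) : Type := EuclideanSpace ℝ (Fin n)

/-- `condCov P x w` is the matrix `E[(x - E[x|w]) (x - E[x|w])ᵀ]`, the covariance matrix of the error
of the best estimate of `x` from `w`. If `x` and `w` are jointly Gaussian vectors, this is the
conditional covariance matrix `Σ_{x|w}`. -/
def condCov {Ω W : Type*} [MeasurableSpace Ω] [mW : MeasurableSpace W] {n : ℕ}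
    (P : Measure Ω) (x : Ω → Vec n) (w : Ω → W) : Matrix (Fin n) (Fin n) ℝ :=
  Matrix.of fun i j =>
    ∫ ω, (x ω - (P[x | mW.comap w]) ω) i * (x ω - (P[x | mW.comap w]) ω) j ∂P

/-- The conditional mutual information `I(y; u | z)` (in nats), an element of `[0, ∞]`: the
Kullback-Leibler divergence of the joint law `P_{z,y,u}` from the law `P_z ⊗ (P_{y|z} × P_{u|z})`
that makes `y` and `u` conditionally independent given `z`. -/
def condMutualInfo {Ω Y U Z : Type*} [MeasurableSpace Ω]
    [MeasurableSpace Y] [StandardBorelSpace Y] [Nonempty Y]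
    [MeasurableSpace U] [StandardBorelSpace U] [Nonempty U] [MeasurableSpace Z]
    (P : Measure Ω) [IsFiniteMeasure P] (y : Ω → Y) (u : Ω → U) (z : Ω → Z) : ℝ≥0∞ :=
  InformationTheory.klDiv (P.map fun ω => (z ω, y ω, u ω))
    ((P.map z) ⊗ₘ ((condDistrib y z P) ×ₖ (condDistrib u z P)))

/-- An element `u` of the class `𝒰` for a source `(x, y, z)` with joint law `μ`: a random variable
`u`, with values in an arbitrary standard Borel space `U`, defined together with a copy of
`(x, y, z)` on some (standard Borel) probability space, such that `u ↔ y ↔ (x, z)` is a Markov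
chain. The probability space is part of the data, as `u` may use randomness that is independent of
the source. -/
structure AuxVar {nx ny nz : ℕ} (μ : Measure (Vec nx × Vec ny × Vec nz)) : Type 1 where
  /-- the sample space -/
  Ω : Type
  [mΩ : MeasurableSpace Ω]
  [sbΩ : StandardBorelSpace Ω]
  /-- the probability measure -/
  P : Measure Ω
  [prob : IsProbabilityMeasure P]
  /-- the space of values of `u` -/
  U : Type
  [mU : MeasurableSpace U]
  [sbU : StandardBorelSpace U]
  [neU : Nonempty U]
  /-- the source -/
  x : Ω → Vec nx
  /-- the observation at the encoder -/
  y : Ω → Vec ny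
  /-- the side information at the decoder -/
  z : Ω → Vec nz
  /-- the encoded variable -/
  u : Ω → U
  measurable_x : Measurable x
  measurable_y : Measurable y
  measurable_z : Measurable z
  measurable_u : Measurable u
  /-- `(x, y, z)` has the law of the source -/
  law : P.map (fun ω => (x ω, y ω, z ω)) = μ
  /-- `u` and `(x, z)` are conditionally independent given `y` -/
  markov : CondIndepFun (MeasurableSpace.comap y inferInstance) measurable_y.comap_le
    u (fun ω => (x ω, z ω)) P

attribute [instance] AuxVar.mΩ AuxVar.sbΩ AuxVar.prob AuxVar.mU AuxVar.sbU AuxVar.neU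

/-- The rate `I(y; u | z)` of an auxiliary variable. -/
def AuxVar.rate {nx ny nz : ℕ} {μ : Measure (Vec nx × Vec ny × Vec nz)} (A : AuxVar μ) : ℝ≥0∞ :=
  condMutualInfo A.P A.y A.u A.z

/-- The reconstruction error covariance `E[(x - x̂) (x - x̂)ᵀ]`, where `x̂ = E[x | u, z]`. -/
def AuxVar.errorCov {nx ny nz : ℕ} {μ : Measure (Vec nx × Vec ny × Vec nz)} (A : AuxVar μ) :
    Matrix (Fin nx) (Fin nx) ℝ :=
  condCov A.P A.x (fun ω => (A.u ω, A.z ω))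

/-- The rate-distortion function `R(D)` of a source `(x, y, z)` with joint law `μ`: the infimum of
`I(y; u | z)` over all `u ∈ 𝒰` with `E[(x - x̂) (x - x̂)ᵀ] ⪯ D`. -/
def rdf {nx ny nz : ℕ} (μ : Measure (Vec nx × Vec ny × Vec nz)) (D : Matrix (Fin nx) (Fin nx) ℝ) :
    ℝ≥0∞ :=
  ⨅ (A : AuxVar μ) (_ : (D - A.errorCov).PosSemidef), A.rate

/-- `V` is a joint diagonalizer of `S₁` and `S₂`: it is nonsingular, `V S₁ Vᵀ = diag(l)` with `l` the
eigenvalues of `S₁` (listed in the order of an eigenvalue decomposition `S₁ = Uᵀ diag(l) U`), and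
`V S₂ Vᵀ = diag(l')`. -/
structure IsJointDiagonalization {n : ℕ} (S₁ S₂ V : Matrix (Fin n) (Fin n) ℝ) (l l' : Fin n → ℝ) :
    Prop where
  eig : ∃ U ∈ Matrix.orthogonalGroup (Fin n) ℝ, S₁ = Uᵀ * Matrix.diagonal l * U
  nonsingular : IsUnit V
  diag₁ : V * S₁ * Vᵀ = Matrix.diagonal l
  diag₂ : V * S₂ * Vᵀ = Matrix.diagonal l'

/-- The upper bound `½ ∑ᵢ log max(λᵢ / λ'ᵢ, 1)`. -/
def upperBound {n : ℕ} (l l' : Fin n → ℝ) : ℝ :=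
  1 / 2 * ∑ i, Real.log (max (l i / l' i) 1)

/-- The lower bound `½ ∑ᵢ log max(λ₍ᵢ₎ / λ'₍ᵢ₎, 1)`, where `λ₍ᵢ₎` and `λ'₍ᵢ₎` are the sorted versions
of `λᵢ` and `λ'ᵢ`. -/
def lowerBound {n : ℕ} (l l' : Fin n → ℝ) : ℝ :=
  upperBound (l ∘ Tuple.sort l) (l' ∘ Tuple.sort l')

end RemoteSource

end

/-! Linear regression splits the source as `x = ψ z + A t + r`, where the innovation `t = y - l z`
is centered Gaussian and independent of `z`, and `r` is centered and independent of `(y, z)`. Hence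
`Σ_{x|yz} = Cov r` and `Σ₁ = Cov (A t)`. The Markov chain makes `r` independent of `(y, z, u)`, so
the error covariance of any `u` is `Cov r` plus the covariance of the error in estimating `ψ z + A
t` from `(u, z)`. The remote problem thus becomes the direct coding of the Gaussian vector `A t`
with target `Σ₂`. A congruence `W` takes `Σ₁` to the identity and `Σ₂` to `diag m` with `0 < m i ≤
1` (`exists_whitening`). Then `e = W A t` is standard Gaussian, and the formula for `R(D)` is `∑
-(log mᵢ)/2`.

Both inequalities rest on one function `f`, the sum over `i` of the log density ratio of `N(kᵢ, mᵢ)`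
to `N(0, 1)` at `eᵢ`. Converse (`ofReal_le_condMutualInfo`): let `k` be the estimate of `e` computed
from `(u, z)`. When `y` and `u` are made conditionally independent given `z`, `e` is still standard
Gaussian given `(u, z)`, so `exp f` has integral 1. The Donsker-Varadhan bound gives `I(y; u | z) ≥
E f`, and `E f ≥ ∑ -(log mᵢ)/2` because the mean squared errors are at most `mᵢ`. Achievability
(`condMutualInfo_testChannel`, `condCov_testChannel`): let `vᵢ = (1 - mᵢ) eᵢ + √(mᵢ (1 - mᵢ)) Nᵢ`
with independent standard noise `N`. Then `e = v + ν` with `ν` independent of `v` and of covariance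
`diag m`. Now `exp f` is exactly the density in the divergence, so the bound is an equality, and the
error covariance is exactly `D`.

The two diagonalization bounds agree because `Σ₂ ⪯ Σ₁` forces `λ'ᵢ ≤ λᵢ`, also after sorting. No
maximum is ever active, and both sums of logarithms collapse to the determinant ratio. -/

/-! ### Independence and conditional laws -/

section Independence

variable {Ω α β γ δ : Type*} [MeasurableSpace Ω] [MeasurableSpace α] [MeasurableSpace β]
  [MeasurableSpace γ] [MeasurableSpace δ] {P : Measure Ω} [IsProbabilityMeasure P]

/-- The law of the triple is a product of three marginals, which may be regrouped. This contraction
rule builds up all the joint independences below. -/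
lemma indepFun_prodMk_right {X : Ω → α} {Y : Ω → β} {Z : Ω → γ} (hX : Measurable X)
    (hY : Measurable Y) (hZ : Measurable Z) (hXY : IndepFun X Y P)
    (hXYZ : IndepFun (fun ω => (X ω, Y ω)) Z P) : IndepFun X (fun ω => (Y ω, Z ω)) P := by
  have hYZ : IndepFun Y Z P := hXYZ.comp measurable_snd measurable_id
  rw [indepFun_iff_map_prod_eq_prod_map_map (by fun_prop) (by fun_prop)] at *
  rw [hYZ, ← Measure.prodAssoc_prod, ← hXY, ← hXYZ, Measure.map_map (by fun_prop) (by fun_prop)]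
  rfl

lemma indepFun_comp_of_map_eq {μ : Measure δ} {h : Ω → δ} (hh : Measurable h) (hμ : P.map h = μ)
    {f : δ → α} {g : δ → β} (hf : Measurable f) (hg : Measurable g) (hfg : IndepFun f g μ) :
    IndepFun (fun ω => f (h ω)) (fun ω => g (h ω)) P := by
  subst hμ
  have := Measure.isProbabilityMeasure_map hh.aemeasurable (μ := P)
  rw [indepFun_iff_map_prod_eq_prod_map_map (by fun_prop) (by fun_prop)] at *
  rw [Measure.map_map (by fun_prop) hh, Measure.map_map (by fun_prop) hh,
    Measure.map_map (by fun_prop) hh] at hfg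
  exact hfg

lemma lintegral_comp_prodMk_of_indepFun {X : Ω → α} {Y : Ω → β} (hX : Measurable X)
    (hY : Measurable Y) (hXY : IndepFun X Y P) {F : α × β → ℝ≥0∞} (hF : Measurable F) :
    ∫⁻ ω, F (X ω, Y ω) ∂P = ∫⁻ ω, ∫⁻ ω', F (X ω, Y ω') ∂P ∂P := by
  rw [← lintegral_map (f := F) (g := fun ω => (X ω, Y ω)) hF (by fun_prop),
    (indepFun_iff_map_prod_eq_prod_map_map (by fun_prop) (by fun_prop)).1 hXY,
    lintegral_prod _ hF.aemeasurable, lintegral_map (by fun_prop) hX]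
  refine lintegral_congr fun ω => ?_
  rw [lintegral_map (by fun_prop) hY]

/-- If `u` is conditionally independent of `v` given `y`, a function `r` of `(y, v)` that is
independent of another function `s` of `(y, v)` which determines `y` is independent of
`(s, u)`. -/
lemma indepFun_prodMk_of_condIndepFun [StandardBorelSpace Ω] {U V Y : Type*} [MeasurableSpace U]
    [StandardBorelSpace U] [Nonempty U] [MeasurableSpace V] [StandardBorelSpace V] [Nonempty V]
    [MeasurableSpace Y] {u : Ω → U} {v : Ω → V} {y : Ω → Y} (hu : Measurable u)
    (hv : Measurable v) (hy : Measurable y)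
    (h : CondIndepFun (MeasurableSpace.comap y inferInstance) hy.comap_le u v P)
    {r : Y × V → α} {s : Y × V → β} {q : β → Y} (hr : Measurable r) (hs : Measurable s)
    (hq : Measurable q) (hqs : ∀ p, q (s p) = p.1)
    (hrs : IndepFun (fun ω => r (y ω, v ω)) (fun ω => s (y ω, v ω)) P) :
    IndepFun (fun ω => r (y ω, v ω)) (fun ω => (s (y ω, v ω), u ω)) P := by
  have h1 := (condIndepFun_iff_condDistrib_prod_ae_eq_prodMkRight hu hv hy).1 h.symm
  rw [condDistrib_ae_eq_iff_measure_eq_compProd _ hu.aemeasurable] at h1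
  set κ := condDistrib u y P with hκ
  -- The Markov property in integral form: given `(y, v)`, the law of `u` is `κ (y)`, which does not
  -- involve `v`.
  have key : ∀ F : (Y × V) × U → ℝ≥0∞, Measurable F →
      ∫⁻ ω, F ((y ω, v ω), u ω) ∂P = ∫⁻ ω, ∫⁻ a, F ((y ω, v ω), a) ∂(κ (y ω)) ∂P := by
    intro F hF
    rw [← lintegral_map (f := F) (g := fun ω => ((y ω, v ω), u ω)) hF (by fun_prop), h1,
      Measure.lintegral_compProd hF, lintegral_map _ (by fun_prop)]
    · rfl
    · exact hF.lintegral_kernel_prod_right'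
  rw [indepFun_iff_map_prod_eq_prod_map_map (by fun_prop) (by fun_prop)]
  refine Measure.ext_of_lintegral _ fun F hF => ?_
  rw [lintegral_map hF (by fun_prop), lintegral_prod _ hF.aemeasurable,
    lintegral_map (by fun_prop) (by fun_prop),
    key (fun p => F (r p.1, (s p.1, p.2))) (by fun_prop)]
  -- Since `s` determines `y`, the inner integral is a function of `r` and `s` alone, and the
  -- independence of `r` and `s` applies to it.
  have e1 : ∀ ω, ∫⁻ a, F (r (y ω, v ω), (s (y ω, v ω), a)) ∂(κ (y ω)) =
      ∫⁻ a, F (r (y ω, v ω), (s (y ω, v ω), a)) ∂(κ (q (s (y ω, v ω)))) := fun ω => by rw [hqs]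
  have hm : Measurable fun p : α × β => ∫⁻ a, F (p.1, (p.2, a)) ∂(κ (q p.2)) :=
    Measurable.lintegral_kernel_prod_right' (κ := κ.comap (fun p : α × β => q p.2) (by fun_prop))
      (f := fun p : (α × β) × U => F (p.1.1, (p.1.2, p.2))) (by fun_prop)
  simp only [e1]
  rw [lintegral_comp_prodMk_of_indepFun
    (F := fun p : α × β => ∫⁻ a, F (p.1, (p.2, a)) ∂(κ (q p.2))) (by fun_prop) (by fun_prop) hrs hm]
  refine lintegral_congr fun ω => ?_
  rw [lintegral_map (by fun_prop) (by fun_prop),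
    key (fun p => F (r (y ω, v ω), (s p.1, p.2))) (by fun_prop)]
  refine lintegral_congr fun ω' => ?_
  rw [hqs]

/-- Conditioning on `z = a` freezes the first argument of `G` and leaves the law of `t` unchanged.
This makes the conditional laws in the mutual information explicit. -/
lemma condDistrib_ae_eq_map_of_indepFun [StandardBorelSpace β] [Nonempty β]
    {z : Ω → α} {t : Ω → γ} (hz : Measurable z) (ht : Measurable t) (hzt : IndepFun z t P)
    {G : α × γ → β} (hG : Measurable G) :
    ∀ᵐ a ∂(P.map z), condDistrib (fun ω => G (z ω, t ω)) z P a =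
      (P.map t).map fun c => G (a, c) := by
  have := Measure.isProbabilityMeasure_map ht.aemeasurable (μ := P)
  let κ : Kernel α β := (Kernel.id ×ₖ Kernel.const α (P.map t)).map G
  have : IsMarkovKernel κ := Kernel.IsMarkovKernel.map _ hG
  have hκ : ∀ a, κ a = (P.map t).map fun c => G (a, c) := by
    intro a
    rw [Kernel.map_apply _ hG, Kernel.prod_apply, Kernel.id_apply, Kernel.const_apply,
      Measure.dirac_prod, Measure.map_map hG (by fun_prop)]
    rfl
  have h := condDistrib_ae_eq_of_measure_eq_compProd (μ := P) (Y := fun ω => G (z ω, t ω)) z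
    (by fun_prop) (κ := κ) ?_
  · filter_upwards [h] with a ha
    rw [ha, hκ]
  · refine Measure.ext_of_lintegral _ fun F hF => ?_
    rw [Measure.lintegral_compProd hF, lintegral_map hF (by fun_prop),
      lintegral_map hF.lintegral_kernel_prod_right' hz,
      lintegral_comp_prodMk_of_indepFun (F := fun p => F (p.1, G p)) hz ht hzt (by fun_prop)]
    refine lintegral_congr fun ω => ?_
    rw [hκ, lintegral_map (by fun_prop) (by fun_prop), lintegral_map (by fun_prop) ht]

/-- A function of `y` and an independent noise `n` is conditionally independent of `v` given `y`. -/
lemma condIndepFun_of_indepFun_noise [StandardBorelSpace Ω] {U V Y : Type*} [MeasurableSpace U]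
    [StandardBorelSpace U] [Nonempty U] [MeasurableSpace V] [StandardBorelSpace V] [Nonempty V]
    [MeasurableSpace Y] {v : Ω → V} {y : Ω → Y} {n : Ω → γ} (hv : Measurable v)
    (hy : Measurable y) (hn : Measurable n) (h : IndepFun (fun ω => (y ω, v ω)) n P)
    {G : Y × γ → U} (hG : Measurable G) :
    CondIndepFun (MeasurableSpace.comap y inferInstance) hy.comap_le
      (fun ω => G (y ω, n ω)) v P := by
  refine CondIndepFun.symm ?_
  refine (condIndepFun_iff_condDistrib_prod_ae_eq_prodMkRight (by fun_prop) hv hy).2 ?_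
  have h1 := condDistrib_ae_eq_map_of_indepFun (P := P) (by fun_prop) hn h
    (G := fun p : (Y × V) × γ => G (p.1.1, p.2)) (by fun_prop)
  have h2 := condDistrib_ae_eq_map_of_indepFun (P := P) hy hn
    (h.comp measurable_fst measurable_id) hG
  have h3 : P.map y = (P.map fun ω => (y ω, v ω)).map Prod.fst := by
    rw [Measure.map_map (by fun_prop) (by fun_prop)]; rfl
  rw [h3] at h2
  filter_upwards [h1, ae_of_ae_map (by fun_prop) h2] with a ha hb
  rw [ha, Kernel.prodMkRight_apply, hb]

end Independence

/-! ### Variational bound for the divergence -/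

section KullbackLeibler

open InformationTheory

variable {α : Type*} [MeasurableSpace α] {P Q : Measure α} [IsProbabilityMeasure P]
  [IsProbabilityMeasure Q] {f : α → ℝ}

/-- The Donsker-Varadhan lower bound for the Kullback-Leibler divergence. -/
lemma ofReal_integral_le_klDiv (hf : Measurable f) (hP : Integrable f P)
    (hQ : ∫⁻ a, ENNReal.ofReal (Real.exp (f a)) ∂Q = 1) :
    ENNReal.ofReal (∫ a, f a ∂P) ≤ klDiv P Q := by
  by_cases hkl : klDiv P Q = ∞
  · simp [hkl]
  obtain ⟨hac, hint⟩ := klDiv_ne_top_iff.1 hkl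
  have hexp : Integrable (fun a => Real.exp (f a)) Q := by
    refine ⟨by fun_prop, ?_⟩
    rw [hasFiniteIntegral_iff_ofReal (.of_forall fun _ => (Real.exp_pos _).le), hQ]
    exact ENNReal.one_lt_top
  have hone : ∫ a, Real.exp (f a) ∂Q = 1 := by
    rw [integral_eq_lintegral_of_nonneg_ae (.of_forall fun _ => (Real.exp_pos _).le) (by fun_prop),
      hQ, ENNReal.toReal_one]
  -- The bound is the nonnegativity of the divergence of `P` from the tilted measure `exp f · Q`,
  -- whose normalizing constant is 1.
  have := isProbabilityMeasure_tilted hexp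
  have hac' : P ≪ Q.tilted f := hac.trans (absolutelyContinuous_tilted hexp)
  have h := integral_llr_add_sub_measure_univ_nonneg hac'
    (integrable_llr_tilted_right hac hP hint hexp)
  rw [integral_llr_tilted_right hac hP hexp hint, hone] at h
  rw [klDiv_of_ac_of_integrable hac hint]
  refine ENNReal.ofReal_le_ofReal ?_
  simp at h ⊢
  exact h

/-- The equality case of the previous bound: when `exp f` is the density, the log-likelihood ratio
is `f` itself. -/
lemma klDiv_withDensity_exp (hf : Measurable f)
    (hPQ : P = Q.withDensity fun a => ENNReal.ofReal (Real.exp (f a))) (hP : Integrable f P) :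
    klDiv P Q = ENNReal.ofReal (∫ a, f a ∂P) := by
  have hac : P ≪ Q := hPQ ▸ withDensity_absolutelyContinuous _ _
  have hllr : llr P Q =ᵐ[P] f := by
    refine hac.ae_le ?_
    have := Measure.rnDeriv_withDensity Q
      (f := fun a => ENNReal.ofReal (Real.exp (f a))) (by fun_prop)
    rw [← hPQ] at this
    filter_upwards [this] with a ha
    rw [llr, ha, ENNReal.toReal_ofReal (Real.exp_pos _).le, Real.log_exp]
  rw [klDiv_of_ac_of_integrable hac (hP.congr hllr.symm), integral_congr_ae hllr]
  simp

end KullbackLeibler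

/-! ### Densities of product measures -/

section ProductMeasure

variable {ι : Type*} [Fintype ι] {α : ι → Type*} [∀ i, MeasurableSpace (α i)]
  (ν : ∀ i, Measure (α i)) [∀ i, IsProbabilityMeasure (ν i)] {g : ∀ i, α i → ℝ≥0∞}

lemma lintegral_pi_prod (hg : ∀ i, Measurable (g i)) :
    ∫⁻ x, ∏ i, g i (x i) ∂(Measure.pi ν) = ∏ i, ∫⁻ x, g i x ∂(ν i) := by
  have h : iIndepFun (fun i (x : ∀ i, α i) => g i (x i)) (Measure.pi ν) :=
    iIndepFun_pi (fun i => (hg i).aemeasurable)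
  rw [lintegral_prod_eq_prod_lintegral_of_indepFun _ _ h
    (fun i => (hg i).comp (measurable_pi_apply i))]
  refine Finset.prod_congr rfl fun i _ => ?_
  rw [← (measurePreserving_eval ν i).lintegral_comp (hg i)]

lemma pi_withDensity (hg : ∀ i, Measurable (g i)) [∀ i, SigmaFinite ((ν i).withDensity (g i))] :
    Measure.pi (fun i => (ν i).withDensity (g i)) =
      (Measure.pi ν).withDensity fun x => ∏ i, g i (x i) := by
  refine Measure.pi_eq fun s hs => ?_
  rw [withDensity_apply _ (MeasurableSet.univ_pi hs),
    ← lintegral_indicator (MeasurableSet.univ_pi hs)]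
  have h : (Set.univ.pi s).indicator (fun x : ∀ i, α i => ∏ i, g i (x i)) =
      fun x => ∏ i, (s i).indicator (g i) (x i) := by
    classical
    ext x
    by_cases hx : x ∈ Set.univ.pi s
    · rw [Set.indicator_of_mem hx]
      exact Finset.prod_congr rfl fun i _ => (Set.indicator_of_mem (hx i trivial) _).symm
    · rw [Set.indicator_of_notMem hx]
      simp only [Set.mem_pi, Set.mem_univ, true_imp_iff, not_forall] at hx
      obtain ⟨i, hi⟩ := hx
      exact (Finset.prod_eq_zero (Finset.mem_univ i) (Set.indicator_of_notMem hi _)).symm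
  rw [h, lintegral_pi_prod ν fun i => (hg i).indicator (hs i)]
  refine Finset.prod_congr rfl fun i _ => ?_
  rw [withDensity_apply _ (hs i), lintegral_indicator (hs i)]

end ProductMeasure

/-! ### The Gaussian density ratio -/

section GaussianRatio

/-- The logarithm of the ratio of the densities at `e` of the Gaussian measures `N(u, m)` and
`N(0, 1)`. -/
noncomputable def gaussianLogRatio (m e u : ℝ) : ℝ :=
  -(Real.log m / 2) - (e - u) ^ 2 / (2 * m) + e ^ 2 / 2

@[fun_prop]
lemma measurable_gaussianLogRatio {α : Type*} [MeasurableSpace α] {m : ℝ} {e u : α → ℝ}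
    (he : Measurable e) (hu : Measurable u) :
    Measurable fun a => gaussianLogRatio m (e a) (u a) := by
  unfold gaussianLogRatio
  fun_prop

lemma exp_gaussianLogRatio {m : ℝ} (hm : 0 < m) (e u : ℝ) :
    Real.exp (gaussianLogRatio m e u) =
      (√m)⁻¹ * Real.exp (- (e - u) ^ 2 / (2 * m) + e ^ 2 / 2) := by
  rw [gaussianLogRatio, ← Real.log_sqrt hm.le, sub_add, sub_eq_add_neg, Real.exp_add, Real.exp_neg,
    Real.exp_log (Real.sqrt_pos.2 hm)]
  congr 2
  ring

/-- The ratio read backwards: it turns the prior of `e` into the law `N(u, m)` of `e` given the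
channel output `u`. -/
lemma gaussianPDFReal_mul_exp_gaussianLogRatio {m : ℝ} (hm : 0 < m) (e u : ℝ) :
    gaussianPDFReal 0 1 e * Real.exp (gaussianLogRatio m e u) =
      gaussianPDFReal u m.toNNReal e := by
  rw [exp_gaussianLogRatio hm, gaussianPDFReal, gaussianPDFReal, Real.coe_toNNReal _ hm.le,
    Real.sqrt_mul (by positivity) m, mul_inv, mul_mul_mul_comm, ← Real.exp_add]
  simp only [NNReal.coe_one, mul_one]
  congr 2
  ring

/-- By Bayes' rule the same ratio read forwards turns the marginal `N(0, 1 - m)` of the output into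
its law `N((1 - m) e, m (1 - m))` given `e`. -/
lemma gaussianPDFReal_mul_exp_gaussianLogRatio' {m : ℝ} (hm : 0 < m) (hm1 : m < 1) (e u : ℝ) :
    gaussianPDFReal 0 (1 - m).toNNReal u * Real.exp (gaussianLogRatio m e u) =
      gaussianPDFReal ((1 - m) * e) (m * (1 - m)).toNNReal u := by
  have h1 : 0 < 1 - m := by linarith
  rw [exp_gaussianLogRatio hm, gaussianPDFReal, gaussianPDFReal, Real.coe_toNNReal _ h1.le,
    Real.coe_toNNReal _ (mul_pos hm h1).le, mul_mul_mul_comm, ← Real.exp_add, ← mul_inv,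
    ← Real.sqrt_mul (by positivity)]
  congr 2
  · ring_nf
  · field_simp
    ring

lemma lintegral_exp_gaussianLogRatio {m : ℝ} (hm : 0 < m) (u : ℝ) :
    ∫⁻ e, ENNReal.ofReal (Real.exp (gaussianLogRatio m e u)) ∂(gaussianReal 0 1) = 1 := by
  rw [gaussianReal_of_var_ne_zero _ one_ne_zero,
    lintegral_withDensity_eq_lintegral_mul _ (measurable_gaussianPDF _ _) (by fun_prop),
    ← lintegral_gaussianPDF_eq_one u (v := m.toNNReal) (by simpa using hm)]
  refine lintegral_congr fun e => ?_
  rw [Pi.mul_apply, gaussianPDF, gaussianPDF, ← ENNReal.ofReal_mul (gaussianPDFReal_nonneg _ _ _),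
    gaussianPDFReal_mul_exp_gaussianLogRatio hm]

lemma gaussianReal_withDensity_gaussianLogRatio {m : ℝ} (hm : 0 < m) (hm1 : m ≤ 1) (e : ℝ) :
    (gaussianReal 0 (1 - m).toNNReal).withDensity
        (fun u => ENNReal.ofReal (Real.exp (gaussianLogRatio m e u))) =
      gaussianReal ((1 - m) * e) (m * (1 - m)).toNNReal := by
  rcases hm1.eq_or_lt with rfl | hlt
  -- For `m = 1` the output is constantly 0: both measures are the Dirac mass at 0, where the ratio
  -- equals 1.
  · have h : (fun u => ENNReal.ofReal (Real.exp (gaussianLogRatio 1 e u))) =ᵐ[Measure.dirac 0]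
        fun _ => 1 := by
      rw [Filter.EventuallyEq, ae_dirac_eq]
      simp [gaussianLogRatio]
    simp only [sub_self, Real.toNNReal_zero, gaussianReal_zero_var, zero_mul, mul_zero]
    rw [withDensity_congr_ae h]
    exact withDensity_one
  · have h1 : 0 < 1 - m := by linarith
    rw [gaussianReal_of_var_ne_zero _ (by simpa using h1),
      gaussianReal_of_var_ne_zero _ (by simpa using mul_pos hm h1),
      ← withDensity_mul _ (measurable_gaussianPDF _ _) (by fun_prop)]
    congr 1
    ext u : 1
    rw [Pi.mul_apply, gaussianPDF, gaussianPDF,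
      ← ENNReal.ofReal_mul (gaussianPDFReal_nonneg _ _ _),
      gaussianPDFReal_mul_exp_gaussianLogRatio' hm hlt]

variable {ι : Type*} [Fintype ι]

lemma lintegral_exp_sum_gaussianLogRatio {m : ι → ℝ} (hm : ∀ i, 0 < m i) (u : ι → ℝ) :
    ∫⁻ e, ENNReal.ofReal (Real.exp (∑ i, gaussianLogRatio (m i) (e i) (u i)))
      ∂(Measure.pi fun _ => gaussianReal 0 1) = 1 := by
  simp only [Real.exp_sum, ENNReal.ofReal_prod_of_nonneg fun _ _ => (Real.exp_pos _).le]
  rw [lintegral_pi_prod (fun _ : ι => gaussianReal 0 1)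
    (g := fun i x => ENNReal.ofReal (Real.exp (gaussianLogRatio (m i) x (u i)))) (by fun_prop)]
  simp [lintegral_exp_gaussianLogRatio (hm _)]

lemma pi_gaussianReal_withDensity_gaussianLogRatio {m : ι → ℝ} (hm : ∀ i, 0 < m i)
    (hm1 : ∀ i, m i ≤ 1) (e : ι → ℝ) :
    (Measure.pi fun i => gaussianReal 0 (1 - m i).toNNReal).withDensity
        (fun u => ENNReal.ofReal (Real.exp (∑ i, gaussianLogRatio (m i) (e i) (u i)))) =
      Measure.pi fun i => gaussianReal ((1 - m i) * e i) (m i * (1 - m i)).toNNReal := by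
  have h : ∀ i, SigmaFinite ((gaussianReal 0 (1 - m i).toNNReal).withDensity
      (fun u => ENNReal.ofReal (Real.exp (gaussianLogRatio (m i) (e i) u)))) := fun i => by
    rw [gaussianReal_withDensity_gaussianLogRatio (hm i) (hm1 i)]; infer_instance
  simp only [Real.exp_sum, ENNReal.ofReal_prod_of_nonneg fun _ _ => (Real.exp_pos _).le]
  rw [← pi_withDensity (fun i => gaussianReal 0 (1 - m i).toNNReal)
    (g := fun i u => ENNReal.ofReal (Real.exp (gaussianLogRatio (m i) (e i) u))) (by fun_prop)]
  simp only [gaussianReal_withDensity_gaussianLogRatio (hm _) (hm1 _)]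

end GaussianRatio

/-! ### Gaussian vectors and linear regression -/

section GaussianLaw

variable {Ω : Type*} [MeasurableSpace Ω] {P : Measure Ω} [IsProbabilityMeasure P]

/-- Uncorrelated coordinates of a jointly Gaussian vector are independent, so means and variances
determine the law. -/
lemma map_eq_pi_gaussianReal {ι : Type*} [Fintype ι] [DecidableEq ι] {X : Ω → ι → ℝ}
    (hX : HasGaussianLaw X P) (h0 : ∀ i, ∫ ω, X ω i ∂P = 0) {v : ι → ℝ}
    (hv : ∀ i j, ∫ ω, X ω i * X ω j ∂P = if i = j then v i else 0) :
    P.map X = Measure.pi fun i => gaussianReal 0 (v i).toNNReal := by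
  have hL2 : ∀ i, MemLp (fun ω => X ω i) 2 P := fun i => (hX.eval i).memLp_two
  have hcov : ∀ i j, cov[fun ω => X ω i, fun ω => X ω j; P] = if i = j then v i else 0 := by
    intro i j
    rw [covariance_eq_sub (hL2 i) (hL2 j), h0, zero_mul, sub_zero, ← hv i j]
    rfl
  have hind : iIndepFun (fun i ω => X ω i) P :=
    hX.iIndepFun_of_covariance_eq_zero fun i j hij => by rw [hcov, if_neg hij]
  have hmap := (iIndepFun_iff_map_fun_eq_pi_map (fun i => (hX.eval i).aemeasurable)).1 hind
  refine hmap.trans ?_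
  congr 1
  ext1 i
  rw [(hX.eval i).map_eq_gaussianReal, h0, ← covariance_self (hX.eval i).aemeasurable, hcov,
    if_pos rfl]

variable {F : Type*} [NormedAddCommGroup F] [NormedSpace ℝ F] [FiniteDimensional ℝ F]

/-- Existence of a linear regression of a real random variable on a random vector. -/
lemma exists_covariance_sub_eq_zero {x : Ω → ℝ} {w : Ω → F} (hx : MemLp x 2 P)
    (hw : MemLp w 2 P) :
    ∃ l : StrongDual ℝ F, ∀ l' : StrongDual ℝ F,
      cov[fun ω => x ω - l (w ω), fun ω => l' (w ω); P] = 0 := by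
  have hl : ∀ l : StrongDual ℝ F, MemLp (fun ω => l (w ω) - ∫ ω, l (w ω) ∂P) 2 P := fun l =>
    (l.comp_memLp' hw).sub (memLp_const _)
  have hint : ∀ l : StrongDual ℝ F, Integrable (fun ω => l (w ω)) P := fun l =>
    (l.comp_memLp' hw).integrable (by norm_num)
  -- The regression is the orthogonal projection of the centered `x` onto the range of `T`, the
  -- finite-dimensional space of centered linear functions of `w`.
  let T : StrongDual ℝ F →ₗ[ℝ] Lp ℝ 2 P :=
    { toFun := fun l => (hl l).toLp _
      map_add' := fun l₁ l₂ => by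
        rw [← MemLp.toLp_add]
        congr 1
        ext ω
        simp only [add_apply, Pi.add_apply]
        rw [integral_add (hint _) (hint _)]
        ring
      map_smul' := fun c l => by
        rw [RingHom.id_apply, ← MemLp.toLp_const_smul]
        congr 1
        ext ω
        simp only [smul_apply, Pi.smul_apply, smul_eq_mul]
        rw [integral_const_mul]
        ring }
  have hx' : MemLp (fun ω => x ω - ∫ ω, x ω ∂P) 2 P := hx.sub (memLp_const _)
  obtain ⟨v, ⟨l, rfl⟩, hv⟩ := Submodule.HasOrthogonalProjection.exists_orthogonal
    (K := LinearMap.range T) (hx'.toLp _)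
  refine ⟨l, fun l' => ?_⟩
  have h := (Submodule.mem_orthogonal' _ _).1 hv (T l') ⟨l', rfl⟩
  change inner ℝ (hx'.toLp _ - (hl l).toLp _) ((hl l').toLp _) = 0 at h
  rw [← MemLp.toLp_sub, L2.inner_def] at h
  rw [covariance, ← h, integral_sub (hx.integrable (by norm_num)) (hint l)]
  refine integral_congr_ae ?_
  filter_upwards [MemLp.coeFn_toLp (hx'.sub (hl l)), MemLp.coeFn_toLp (hl l')] with ω h1 h2
  rw [h1, h2]
  simp only [Pi.sub_apply, RCLike.inner_apply, conj_trivial]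
  ring

/-- Regress each coordinate separately. The residual is uncorrelated with every linear function of
`w`, and joint Gaussianity upgrades this to independence. -/
lemma exists_indepFun_sub [MeasurableSpace F] [BorelSpace F] {n : ℕ} {x : Ω → EuclideanSpace ℝ (Fin n)} {w : Ω → F}
    (h : HasGaussianLaw (fun ω => (x ω, w ω)) P) :
    ∃ L : F →L[ℝ] EuclideanSpace ℝ (Fin n), IndepFun (fun ω => x ω - L (w ω)) w P := by
  have hxi : ∀ i, MemLp (fun ω => x ω i) 2 P := fun i =>
    (EuclideanSpace.proj (𝕜 := ℝ) i).comp_memLp' h.fst.memLp_two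
  choose l hl using fun i => exists_covariance_sub_eq_zero (hxi i) h.snd.memLp_two
  let L : F →L[ℝ] EuclideanSpace ℝ (Fin n) :=
    (EuclideanSpace.equiv (Fin n) ℝ).symm.toContinuousLinearMap ∘L ContinuousLinearMap.pi l
  have hL : ∀ a i, L a i = l i a := fun a i => rfl
  refine ⟨L, HasGaussianLaw.indepFun_of_covariance_strongDual ?_ fun L₁ L₂ => ?_⟩
  · exact h.map_fun (((ContinuousLinearMap.fst ℝ _ F) - L ∘L (ContinuousLinearMap.snd ℝ _ F)).prod
      (ContinuousLinearMap.snd ℝ _ F))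
  · have hsum : L₁ ∘ (fun ω => x ω - L (w ω)) = fun ω =>
        ∑ i, L₁ (EuclideanSpace.basisFun (Fin n) ℝ i) * (x ω i - l i (w ω)) := by
      ext ω
      rw [Function.comp_apply, ← (EuclideanSpace.basisFun (Fin n) ℝ).sum_repr (x ω - L (w ω)),
        map_sum]
      refine Finset.sum_congr rfl fun i _ => ?_
      rw [map_smul, EuclideanSpace.basisFun_repr, PiLp.sub_apply, hL, smul_eq_mul, mul_comm]
    rw [hsum, covariance_fun_sum_left]
    · refine Finset.sum_eq_zero fun i _ => ?_
      rw [covariance_const_mul_left]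
      exact mul_eq_zero_of_right _ (hl i L₂)
    · exact fun i => ((hxi i).sub ((l i).comp_memLp' h.snd.memLp_two)).const_mul _
    · exact L₂.comp_memLp' h.snd.memLp_two

end GaussianLaw

/-! ### Simultaneous diagonalization and the two bounds -/

section SimultaneousDiagonalization

variable {n : ℕ} {S₁ S₂ : Matrix (Fin n) (Fin n) ℝ}

lemma Matrix.IsHermitian.exists_orthogonal_diagonal {S : Matrix (Fin n) (Fin n) ℝ}
    (hS : S.IsHermitian) :
    ∃ U ∈ Matrix.orthogonalGroup (Fin n) ℝ, ∃ l, S = Uᵀ * Matrix.diagonal l * U := by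
  refine ⟨(hS.eigenvectorUnitary : Matrix (Fin n) (Fin n) ℝ)ᵀ, ?_, hS.eigenvalues, ?_⟩
  · exact Unitary.star_mem hS.eigenvectorUnitary.2
  · conv_lhs => rw [hS.spectral_theorem, Unitary.conjStarAlgAut_apply]
    rw [Matrix.transpose_transpose]
    rfl

lemma Matrix.PosDef.mul_mul_transpose {S V : Matrix (Fin n) (Fin n) ℝ} (hS : S.PosDef)
    (hV : IsUnit V) : (V * S * Vᵀ).PosDef := by
  simpa using hS.mul_mul_conjTranspose_same (B := V) (Matrix.vecMul_injective_of_isUnit hV)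

lemma Matrix.PosSemidef.mul_mul_transpose {S : Matrix (Fin n) (Fin n) ℝ} (hS : S.PosSemidef)
    (V : Matrix (Fin n) (Fin n) ℝ) : (V * S * Vᵀ).PosSemidef := by
  simpa using hS.mul_mul_conjTranspose_same V

/-- An eigenbasis of `S₁`, rescaled by `1/√l`, takes `S₁` to the identity. A further rotation `R`
diagonalizes the image of `S₂` and does not disturb the identity. The bounds on `m` come from `0 ≺
S₂ ⪯ S₁`. -/
lemma exists_whitening (h₁ : S₁.PosDef) (h₂ : S₂.PosDef) (h : (S₁ - S₂).PosSemidef) :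
    ∃ (U W : Matrix (Fin n) (Fin n) ℝ) (l m : Fin n → ℝ),
      U ∈ Matrix.orthogonalGroup (Fin n) ℝ ∧ S₁ = Uᵀ * Matrix.diagonal l * U ∧ (∀ i, 0 < l i) ∧
      IsUnit W ∧ W * S₁ * Wᵀ = 1 ∧ W * S₂ * Wᵀ = Matrix.diagonal m ∧
      ∀ i, 0 < m i ∧ m i ≤ 1 := by
  obtain ⟨U, hU, l, hl⟩ := h₁.isHermitian.exists_orthogonal_diagonal
  have hUU : U * Uᵀ = 1 := (Matrix.mem_orthogonalGroup_iff (A := U)).1 hU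
  have hUu : IsUnit U := IsUnit.of_mul_eq_one _ hUU
  have hdiag : U * S₁ * Uᵀ = Matrix.diagonal l := by
    rw [hl]
    calc U * (Uᵀ * Matrix.diagonal l * U) * Uᵀ
        = (U * Uᵀ) * Matrix.diagonal l * (U * Uᵀ) := by simp only [Matrix.mul_assoc]
      _ = _ := by rw [hUU, Matrix.one_mul, Matrix.mul_one]
  have hlpos : ∀ i, 0 < l i := by
    have := h₁.mul_mul_transpose hUu
    rw [hdiag] at this
    exact Matrix.posDef_diagonal_iff.1 this
  have hsq : ∀ i, √(l i) ≠ 0 := fun i => (Real.sqrt_pos.2 (hlpos i)).ne'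
  set W₀ := Matrix.diagonal (fun i => (√(l i))⁻¹) * U with hW₀
  have hW₀1 : W₀ * S₁ * W₀ᵀ = 1 := by
    rw [hW₀, Matrix.transpose_mul, Matrix.diagonal_transpose]
    calc Matrix.diagonal (fun i => (√(l i))⁻¹) * U * S₁ *
          (Uᵀ * Matrix.diagonal (fun i => (√(l i))⁻¹))
        = Matrix.diagonal (fun i => (√(l i))⁻¹) * (U * S₁ * Uᵀ) *
          Matrix.diagonal (fun i => (√(l i))⁻¹) := by simp only [Matrix.mul_assoc]
      _ = 1 := by
        rw [hdiag, Matrix.diagonal_mul_diagonal, Matrix.diagonal_mul_diagonal,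
          ← Matrix.diagonal_one]
        congr 1
        ext i
        have := hsq i
        field_simp
        exact (Real.sq_sqrt (hlpos i).le).symm
  have hW₀u : IsUnit W₀ := IsUnit.of_mul_eq_one (S₁ * W₀ᵀ) (by rw [← Matrix.mul_assoc, hW₀1])
  obtain ⟨R, hR, m, hm⟩ := (h₂.mul_mul_transpose hW₀u).isHermitian.exists_orthogonal_diagonal
  have hRR : R * Rᵀ = 1 := (Matrix.mem_orthogonalGroup_iff (A := R)).1 hR
  have hWu : IsUnit (R * W₀) := (IsUnit.of_mul_eq_one _ hRR).mul hW₀u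
  have e1 : (R * W₀) * S₁ * (R * W₀)ᵀ = 1 := by
    rw [Matrix.transpose_mul]
    calc R * W₀ * S₁ * (W₀ᵀ * Rᵀ) = R * (W₀ * S₁ * W₀ᵀ) * Rᵀ := by simp only [Matrix.mul_assoc]
      _ = 1 := by rw [hW₀1, Matrix.mul_one, hRR]
  have e2 : (R * W₀) * S₂ * (R * W₀)ᵀ = Matrix.diagonal m := by
    rw [Matrix.transpose_mul]
    calc R * W₀ * S₂ * (W₀ᵀ * Rᵀ) = R * (W₀ * S₂ * W₀ᵀ) * Rᵀ := by simp only [Matrix.mul_assoc]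
      _ = (R * Rᵀ) * Matrix.diagonal m * (R * Rᵀ) := by rw [hm]; simp only [Matrix.mul_assoc]
      _ = _ := by rw [hRR, Matrix.one_mul, Matrix.mul_one]
  refine ⟨U, R * W₀, l, m, hU, hl, hlpos, hWu, e1, e2, fun i => ⟨?_, ?_⟩⟩
  · have := h₂.mul_mul_transpose hWu
    rw [e2] at this
    exact Matrix.posDef_diagonal_iff.1 this i
  · have := (h.mul_mul_transpose (R * W₀)).diag_nonneg (i := i)
    rw [Matrix.mul_sub, Matrix.sub_mul, e1, e2] at this
    simpa using this

lemma exists_isJointDiagonalization (h₁ : S₁.PosDef) (h₂ : S₂.PosDef)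
    (h : (S₁ - S₂).PosSemidef) :
    ∃ V l l', RemoteSource.IsJointDiagonalization S₁ S₂ V l l' := by
  obtain ⟨U, W, l, m, hU, hl, hlpos, hWu, e1, e2, -⟩ := exists_whitening h₁ h₂ h
  have hsq : ∀ i, √(l i) * √(l i) = l i := fun i => Real.mul_self_sqrt (hlpos i).le
  have hconj : ∀ S : Matrix (Fin n) (Fin n) ℝ,
      Matrix.diagonal (fun i => √(l i)) * W * S * (Matrix.diagonal (fun i => √(l i)) * W)ᵀ =
        Matrix.diagonal (fun i => √(l i)) * (W * S * Wᵀ) * Matrix.diagonal (fun i => √(l i)) := by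
    intro S
    rw [Matrix.transpose_mul, Matrix.diagonal_transpose]
    simp only [Matrix.mul_assoc]
  -- Scaling the whitening by `√l` replaces the identity by `diag l`, so the diagonal entries are
  -- eigenvalues of `S₁` as required.
  refine ⟨Matrix.diagonal (fun i => √(l i)) * W, l, fun i => √(l i) * m i * √(l i),
    ⟨U, hU, hl⟩, IsUnit.mul ?_ hWu, ?_, ?_⟩
  · rw [Matrix.isUnit_diagonal, Pi.isUnit_iff]
    exact fun i => (Real.sqrt_pos.2 (hlpos i)).ne'.isUnit
  · rw [hconj, e1, Matrix.mul_one, Matrix.diagonal_mul_diagonal]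
    simp only [hsq]
  · rw [hconj, e2, Matrix.diagonal_mul_diagonal, Matrix.diagonal_mul_diagonal]

lemma comp_sort_le_comp_sort {f g : Fin n → ℝ} (h : f ≤ g) :
    f ∘ Tuple.sort f ≤ g ∘ Tuple.sort g := by
  intro i
  by_contra! hlt
  -- Pigeonhole: if the `i`-th smallest value of `g` were below that of `f`, the indices of the `i +
  -- 1` smallest values of `g` would all fall in the first `i` positions of the ordering of `f`.
  have hmaps : ∀ j ∈ Finset.Iic i,
      (Tuple.sort f).symm (Tuple.sort g j) ∈ Finset.Iio i := by
    intro j hj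
    rw [Finset.mem_Iio]
    by_contra! hk
    have h1 := Tuple.monotone_sort f hk
    have h2 := Tuple.monotone_sort g (Finset.mem_Iic.1 hj)
    have h3 := h (Tuple.sort g j)
    simp only [Function.comp_apply, Equiv.apply_symm_apply] at h1 h2 hlt
    linarith
  have := Finset.card_le_card_of_injOn _ hmaps
    ((Equiv.injective _).comp (Equiv.injective _)).injOn
  simp at this

lemma bounds_eq_of_isJointDiagonalization (h₁ : S₁.PosDef) (h₂ : S₂.PosDef)
    (h : (S₁ - S₂).PosSemidef) {V : Matrix (Fin n) (Fin n) ℝ} {l l' : Fin n → ℝ}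
    (hV : RemoteSource.IsJointDiagonalization S₁ S₂ V l l') :
    RemoteSource.lowerBound l l' = 1 / 2 * Real.log (S₁.det / S₂.det) ∧
      RemoteSource.upperBound l l' = 1 / 2 * Real.log (S₁.det / S₂.det) := by
  have hl : ∀ i, 0 < l i := by
    have := h₁.mul_mul_transpose hV.nonsingular
    rw [hV.diag₁] at this
    exact Matrix.posDef_diagonal_iff.1 this
  have hl' : ∀ i, 0 < l' i := by
    have := h₂.mul_mul_transpose hV.nonsingular
    rw [hV.diag₂] at this
    exact Matrix.posDef_diagonal_iff.1 this
  have hle : l' ≤ l := by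
    intro i
    have := (h.mul_mul_transpose V).diag_nonneg (i := i)
    rw [Matrix.mul_sub, Matrix.sub_mul, hV.diag₁, hV.diag₂] at this
    simpa using this
  -- Both determinants pick up the same factor `(det V)²`, which cancels in the ratio.
  have hratio : Real.log (S₁.det / S₂.det) = ∑ i, Real.log (l i) - ∑ i, Real.log (l' i) := by
    have e1 := congrArg Matrix.det hV.diag₁
    have e2 := congrArg Matrix.det hV.diag₂
    rw [Matrix.det_mul, Matrix.det_mul, Matrix.det_transpose, Matrix.det_diagonal] at e1 e2
    have hV0 : V.det ≠ 0 := ((Matrix.isUnit_iff_isUnit_det V).1 hV.nonsingular).ne_zero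
    rw [← Real.log_prod fun i _ => (hl i).ne', ← Real.log_prod fun i _ => (hl' i).ne',
      ← e1, ← e2, ← Real.log_div]
    · congr 1
      have := h₂.det_pos.ne'
      field_simp
    · exact mul_ne_zero (mul_ne_zero hV0 h₁.det_pos.ne') hV0
    · exact mul_ne_zero (mul_ne_zero hV0 h₂.det_pos.ne') hV0
  have hub : ∀ {a b : Fin n → ℝ}, (∀ i, 0 < b i) → b ≤ a →
      RemoteSource.upperBound a b =
        1 / 2 * (∑ i, Real.log (a i) - ∑ i, Real.log (b i)) := by
    intro a b hb hba
    rw [RemoteSource.upperBound, ← Finset.sum_sub_distrib]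
    congr 1
    refine Finset.sum_congr rfl fun i _ => ?_
    rw [max_eq_left ((one_le_div (hb i)).2 (hba i)),
      Real.log_div ((hb i).trans_le (hba i)).ne' (hb i).ne']
  refine ⟨?_, by rw [hub hl' hle, hratio]⟩
  rw [RemoteSource.lowerBound, hub (b := l' ∘ Tuple.sort l') (fun i => hl' _) (comp_sort_le_comp_sort hle), hratio]
  congr 2
  · exact Equiv.sum_comp (Tuple.sort l) fun i => Real.log (l i)
  · exact Equiv.sum_comp (Tuple.sort l') fun i => Real.log (l' i)

lemma log_det_div_det_of_whitening (h₂ : S₂.PosDef)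
    {W : Matrix (Fin n) (Fin n) ℝ} {m : Fin n → ℝ} (hm : ∀ i, 0 < m i) (hW : W * S₁ * Wᵀ = 1)
    (hW' : W * S₂ * Wᵀ = Matrix.diagonal m) :
    1 / 2 * Real.log (S₁.det / S₂.det) = ∑ i, -(Real.log (m i) / 2) := by
  have e1 := congrArg Matrix.det hW
  have e2 := congrArg Matrix.det hW'
  rw [Matrix.det_mul, Matrix.det_mul, Matrix.det_transpose] at e1 e2
  rw [Matrix.det_diagonal] at e2
  rw [Matrix.det_one] at e1
  have h0 : S₁.det / S₂.det = (∏ i, m i)⁻¹ := by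
    have hp : (∏ i, m i) ≠ 0 := (Finset.prod_pos fun i _ => hm i).ne'
    have := h₂.det_pos.ne'
    field_simp
    rw [← e2]
    linear_combination S₂.det * e1
  rw [h0, Real.log_inv, Real.log_prod fun i _ => (hm i).ne', Finset.sum_neg_distrib,
    ← Finset.sum_div]
  ring

end SimultaneousDiagonalization

open RemoteSource (Vec condCov)

/-! ### Error covariances under independent errors -/

section ConditionalCovariance

variable {Ω V W : Type*} [MeasurableSpace Ω] [MeasurableSpace V] [MeasurableSpace W]
  {P : Measure Ω} {n : ℕ}

lemma RemoteSource.memLp_coord {x : Ω → Vec n} (hx : MemLp x 2 P) (i : Fin n) :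
    MemLp (fun ω => x ω i) 2 P :=
  (EuclideanSpace.proj (𝕜 := ℝ) i).comp_memLp' hx

lemma integral_mulVec_mul_mulVec {d : Ω → Vec n} (hd : MemLp d 2 P)
    (W C : Matrix (Fin n) (Fin n) ℝ) (hC : ∀ i j, C i j = ∫ ω, d ω i * d ω j ∂P) (i j : Fin n) :
    ∫ ω, (W *ᵥ d ω) i * (W *ᵥ d ω) j ∂P = (W * C * Wᵀ) i j := by
  have hI : ∀ a b, Integrable (fun ω => W i a * d ω a * (W j b * d ω b)) P := fun a b =>
    ((RemoteSource.memLp_coord hd a).const_mul _).integrable_mul ((RemoteSource.memLp_coord hd b).const_mul _)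
  simp only [Matrix.mulVec, dotProduct, Finset.sum_mul_sum]
  rw [integral_finsetSum _ fun a _ => integrable_finsetSum _ fun b _ => hI a b]
  simp only [Matrix.mul_apply, Matrix.transpose_apply, Finset.sum_mul]
  rw [Finset.sum_comm]
  refine Finset.sum_congr rfl fun b _ => ?_
  rw [integral_finsetSum _ fun a _ => hI b a]
  refine Finset.sum_congr rfl fun a _ => ?_
  rw [hC, ← integral_const_mul, ← integral_mul_const]
  congr 1
  ext ω
  ring

variable [IsProbabilityMeasure P]

lemma RemoteSource.integral_coord {x : Ω → Vec n} (hx : MemLp x 2 P) (i : Fin n) :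
    ∫ ω, x ω i ∂P = (∫ ω, x ω ∂P) i :=
  (EuclideanSpace.proj (𝕜 := ℝ) i).integral_comp_comm (hx.integrable (by norm_num))

open RemoteSource

lemma integral_add_mul_add_of_indepFun {a b : Ω → Vec n} (ha : MemLp a 2 P) (hb : MemLp b 2 P)
    (hb0 : ∫ ω, b ω ∂P = 0) (hab : IndepFun a b P) (i j : Fin n) :
    ∫ ω, (a ω + b ω) i * (a ω + b ω) j ∂P =
      ∫ ω, a ω i * a ω j ∂P + ∫ ω, b ω i * b ω j ∂P := by
  have hI : ∀ {a b : Ω → ℝ}, MemLp a 2 P → MemLp b 2 P → Integrable (fun ω => a ω * b ω) P :=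
    fun ha hb => ha.integrable_mul hb
  have hI1 := hI (memLp_coord ha i) (memLp_coord ha j)
  have hI2 := hI (memLp_coord hb i) (memLp_coord hb j)
  have hI3 := hI (memLp_coord ha i) (memLp_coord hb j)
  have hI4 := hI (memLp_coord ha j) (memLp_coord hb i)
  have hcross : ∀ i j, ∫ ω, a ω i * b ω j ∂P = 0 := by
    intro i j
    refine (IndepFun.integral_fun_mul_eq_mul_integral (hab.comp (φ := fun v : Vec n => v i)
      (ψ := fun v : Vec n => v j) (by fun_prop) (by fun_prop))
      (memLp_coord ha i).1 (memLp_coord hb j).1).trans (mul_eq_zero_of_right _ ?_)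
    exact (integral_coord hb j).trans (by rw [hb0]; rfl)
  have hexp : ∀ ω, (a ω + b ω) i * (a ω + b ω) j =
      (a ω i * a ω j + b ω i * b ω j) + (a ω i * b ω j + a ω j * b ω i) := by
    intro ω
    rw [PiLp.add_apply, PiLp.add_apply]
    ring
  simp only [hexp]
  rw [integral_add (by exact hI1.add hI2) (by exact hI3.add hI4), integral_add hI1 hI2,
    integral_add hI3 hI4, hcross, hcross, add_zero, add_zero]

lemma condExp_add_of_indepFun {f r : Ω → Vec n} {w : Ω → W} (hw : Measurable w)
    (hr : Measurable r) (hf : MemLp f 2 P) (hr2 : MemLp r 2 P) (hr0 : ∫ ω, r ω ∂P = 0)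
    (hrw : IndepFun r w P) :
    P[fun ω => f ω + r ω | MeasurableSpace.comap w inferInstance] =ᵐ[P]
      P[f | MeasurableSpace.comap w inferInstance] := by
  have h1 := condExp_add (hf.integrable (by norm_num)) (hr2.integrable (by norm_num))
    (MeasurableSpace.comap w inferInstance)
  have h2 := condExp_indep_eq (μ := P) (f := r) hr.comap_le hw.comap_le
    (Measurable.stronglyMeasurable (comap_measurable r)) hrw
  filter_upwards [h1, h2] with ω h1 h2
  refine h1.trans ?_
  rw [Pi.add_apply, h2, hr0, add_zero]

/-- The error covariance of the best estimate from `w` of the sum of a function of `w` and an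
independent error `r` is the covariance of `r`. -/
lemma condCov_add_eq_of_indepFun {φ : W → Vec n} {r : Ω → Vec n} {w : Ω → W} (hw : Measurable w)
    (hφ : Measurable φ) (hr : Measurable r) (hf : MemLp (fun ω => φ (w ω)) 2 P)
    (hr2 : MemLp r 2 P) (hr0 : ∫ ω, r ω ∂P = 0) (hrw : IndepFun r w P) (i j : Fin n) :
    condCov P (fun ω => φ (w ω) + r ω) w i j = ∫ ω, r ω i * r ω j ∂P := by
  have h := condExp_add_of_indepFun hw hr hf hr2 hr0 hrw
  have h' : P[fun ω => φ (w ω) | MeasurableSpace.comap w inferInstance] = fun ω => φ (w ω) :=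
    condExp_of_stronglyMeasurable hw.comap_le
      (Measurable.stronglyMeasurable (hφ.comp (comap_measurable w)))
      (hf.integrable (by norm_num))
  rw [h'] at h
  refine integral_congr_ae ?_
  filter_upwards [h] with ω hω
  rw [hω, add_sub_cancel_left]

/-- The error covariance of the best estimate from `w = q v` of the sum of a function of `v` and
an error `r` that is independent of `v` is the sum of two error covariances. -/
lemma exists_condCov_add_eq {φ : V → Vec n} {r : Ω → Vec n} {v : Ω → V} {q : V → W}
    (hv : Measurable v) (hq : Measurable q)
    (hφ : Measurable φ) (hr : Measurable r) (hf : MemLp (fun ω => φ (v ω)) 2 P)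
    (hr2 : MemLp r 2 P) (hr0 : ∫ ω, r ω ∂P = 0) (hrv : IndepFun r v P) :
    ∃ g : W → Vec n, Measurable g ∧ MemLp (fun ω => φ (v ω) - g (q (v ω))) 2 P ∧
      ∀ i j, condCov P (fun ω => φ (v ω) + r ω) (fun ω => q (v ω)) i j =
        (∫ ω, (φ (v ω) - g (q (v ω))) i * (φ (v ω) - g (q (v ω))) j ∂P) +
          ∫ ω, r ω i * r ω j ∂P := by
  have hw : Measurable fun ω => q (v ω) := hq.comp hv
  have h := condExp_add_of_indepFun hw hr hf hr2 hr0 (hrv.comp measurable_id hq)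
  -- The conditional expectation given `q v` factors through `q v`; `g` is the resulting estimator.
  obtain ⟨g, hg, hge⟩ := Measurable.exists_eq_measurable_comp (stronglyMeasurable_condExp
    (μ := P) (f := fun ω => φ (v ω))
    (m := MeasurableSpace.comap (fun ω => q (v ω)) inferInstance)).measurable
  have hd : MemLp (fun ω => φ (v ω) - g (q (v ω))) 2 P := by
    have : MemLp (fun ω => g (q (v ω))) 2 P := by
      have := hf.condExp (m := MeasurableSpace.comap (fun ω => q (v ω)) inferInstance) (by norm_num)
      rwa [hge] at this
    exact hf.sub this
  refine ⟨g, hg, hd, fun i j => ?_⟩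
  rw [hge] at h
  refine Eq.trans (integral_congr_ae ?_) (integral_add_mul_add_of_indepFun hd hr2 hr0
    (hrv.symm.comp (φ := fun a => φ a - g (q a)) (by fun_prop) measurable_id) i j)
  filter_upwards [h] with ω hω
  rw [hω]
  simp only [PiLp.sub_apply, PiLp.add_apply, Function.comp_apply]
  ring

end ConditionalCovariance

/-! ### Gaussian regression of the source -/

section Regression

variable {nx ny nz : ℕ}

/-- The source is decomposed as `x = ψ z + A t + r` with `t = y - l z`, where `t` is a centered
Gaussian vector that is independent of `z`, and `r` is centered and independent of `(y, z)`. -/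
structure IsGaussianRegression {Ω : Type*} [MeasurableSpace Ω] (P : Measure Ω) (x : Ω → Vec nx)
    (y : Ω → Vec ny) (z : Ω → Vec nz) (A : Vec ny →L[ℝ] Vec nx)
    (l : Vec nz → Vec ny) (ψ : Vec nz → Vec nx) : Prop where
  measurable_l : Measurable l
  measurable_ψ : Measurable ψ
  memLp_x : MemLp x 2 P
  memLp_resid : MemLp (fun ω => x ω - (ψ (z ω) + A (y ω - l (z ω)))) 2 P
  integral_resid : ∫ ω, x ω - (ψ (z ω) + A (y ω - l (z ω))) ∂P = 0
  indepFun_resid : IndepFun (fun ω => x ω - (ψ (z ω) + A (y ω - l (z ω))))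
    (fun ω => (y ω, z ω)) P
  hasGaussianLaw_innov : HasGaussianLaw (fun ω => y ω - l (z ω)) P
  integral_innov : ∫ ω, y ω - l (z ω) ∂P = 0
  indepFun_innov : IndepFun (fun ω => y ω - l (z ω)) z P

lemma hasGaussianLaw_sub_const {Ω : Type*} [MeasurableSpace Ω] {P : Measure Ω} {n : ℕ}
    {X : Ω → Vec n} (hX : HasGaussianLaw X P) (c : Vec n) :
    HasGaussianLaw (fun ω => X ω - c) P := by
  have := hX.isGaussian_map
  refine ⟨?_⟩
  have h : P.map (fun ω => X ω - c) = (P.map X).map (fun a => a - c) := by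
    rw [AEMeasurable.map_map_of_aemeasurable (by fun_prop) hX.aemeasurable]
    rfl
  rw [h]
  infer_instance

lemma exists_isGaussianRegression (μ : Measure (Vec nx × Vec ny × Vec nz)) [IsGaussian μ] :
    ∃ A l ψ, IsGaussianRegression μ (fun p => p.1) (fun p => p.2.1) (fun p => p.2.2) A l ψ := by
  have hG : HasGaussianLaw (fun p : Vec nx × Vec ny × Vec nz => (p.1, p.2)) μ :=
    IsGaussian.hasGaussianLaw_id
  obtain ⟨L₁, h₁⟩ := exists_indepFun_sub hG
  obtain ⟨L₂, h₂⟩ := exists_indepFun_sub (x := fun p : Vec nx × Vec ny × Vec nz => p.2.1)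
    (w := fun p => p.2.2) hG.snd
  have g₁ : HasGaussianLaw (fun p : Vec nx × Vec ny × Vec nz => p.1 - L₁ p.2) μ :=
    hG.map_fun (ContinuousLinearMap.fst ℝ _ _ - L₁ ∘L ContinuousLinearMap.snd ℝ _ _)
  have g₂ : HasGaussianLaw (fun p : Vec nx × Vec ny × Vec nz => p.2.1 - L₂ p.2.2) μ :=
    HasGaussianLaw.map_fun hG.snd
      (ContinuousLinearMap.fst ℝ _ _ - L₂ ∘L ContinuousLinearMap.snd ℝ _ _)
  set c₁ := ∫ p : Vec nx × Vec ny × Vec nz, p.1 - L₁ p.2 ∂μ with hc₁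
  set c₂ := ∫ p : Vec nx × Vec ny × Vec nz, p.2.1 - L₂ p.2.2 ∂μ with hc₂
  -- With `l z = L₂ z + c₂`, the regression `L₁ (y, z)` splits into its value at `(l z, z)`, which
  -- goes into `ψ`, and its linear part in `y - l z`, which is `A`. The constants `c₁`, `c₂` center
  -- the residuals.
  have e₁ : ∀ p : Vec nx × Vec ny × Vec nz, p.1 - (L₁ (L₂ p.2.2 + c₂, p.2.2) + c₁ +
      (L₁ ∘L ContinuousLinearMap.inl ℝ _ _) (p.2.1 - (L₂ p.2.2 + c₂))) = p.1 - L₁ p.2 - c₁ := by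
    intro p
    have : L₁ p.2 = L₁ (L₂ p.2.2 + c₂, p.2.2) + L₁ (p.2.1 - (L₂ p.2.2 + c₂), 0) := by
      rw [← map_add]
      congr 1
      ext <;> simp
    rw [this]
    simp only [ContinuousLinearMap.comp_apply, ContinuousLinearMap.inl_apply]
    abel
  have e₂ : ∀ p : Vec nx × Vec ny × Vec nz, p.2.1 - (L₂ p.2.2 + c₂) = p.2.1 - L₂ p.2.2 - c₂ :=
    fun p => by abel
  refine ⟨L₁ ∘L ContinuousLinearMap.inl ℝ _ _, fun z => L₂ z + c₂,
    fun z => L₁ (L₂ z + c₂, z) + c₁, by fun_prop, by fun_prop, hG.fst.memLp_two,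
    ?_, ?_, ?_, ?_, ?_, ?_⟩
  · simp only [e₁]
    exact g₁.memLp_two.sub (memLp_const _)
  · simp only [e₁]
    rw [integral_sub g₁.integrable (integrable_const _), ← hc₁]
    simp
  · simp only [e₁]
    exact h₁.comp (φ := fun a => a - c₁) (by fun_prop) measurable_id
  · simp only [e₂]
    exact hasGaussianLaw_sub_const g₂ _
  · simp only [e₂]
    rw [integral_sub g₂.integrable (integrable_const _), ← hc₂]
    simp
  · simp only [e₂]
    exact h₂.comp (φ := fun a => a - c₂) (by fun_prop) measurable_id

end Regression

/-! ### Conditional covariances through the regression -/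

namespace IsGaussianRegression

variable {nx ny nz : ℕ} {Ω : Type*} [MeasurableSpace Ω] {P : Measure Ω}
  {x : Ω → Vec nx} {y : Ω → Vec ny} {z : Ω → Vec nz} {A : Vec ny →L[ℝ] Vec nx}
  {l : Vec nz → Vec ny} {ψ : Vec nz → Vec nx}

lemma memLp_innov (h : IsGaussianRegression P x y z A l ψ) :
    MemLp (fun ω => A (y ω - l (z ω))) 2 P :=
  A.comp_memLp' h.hasGaussianLaw_innov.memLp_two

lemma integral_comp_innov (h : IsGaussianRegression P x y z A l ψ) :
    ∫ ω, A (y ω - l (z ω)) ∂P = 0 := by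
  rw [A.integral_comp_comm h.hasGaussianLaw_innov.integrable, h.integral_innov, map_zero]

variable [IsProbabilityMeasure P]

lemma of_map_eq {μ : Measure (Vec nx × Vec ny × Vec nz)}
    (h : IsGaussianRegression μ (fun p => p.1) (fun p => p.2.1) (fun p => p.2.2) A l ψ)
    (hx : Measurable x) (hy : Measurable y) (hz : Measurable z)
    (hμ : P.map (fun ω => (x ω, y ω, z ω)) = μ) : IsGaussianRegression P x y z A l ψ := by
  have hl := h.measurable_l
  have hψ := h.measurable_ψ
  have hm : Measurable fun ω => (x ω, y ω, z ω) := by fun_prop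
  have hr : Measurable fun p : Vec nx × Vec ny × Vec nz => p.1 - (ψ p.2.2 + A (p.2.1 - l p.2.2)) :=
    by fun_prop
  have ht : Measurable fun p : Vec nx × Vec ny × Vec nz => p.2.1 - l p.2.2 := by fun_prop
  refine ⟨hl, hψ, ?_, ?_, ?_, ?_, ?_, ?_, ?_⟩
  · have := h.memLp_x
    rw [← hμ] at this
    exact this.comp_of_map hm.aemeasurable
  · have := h.memLp_resid
    rw [← hμ] at this
    exact this.comp_of_map hm.aemeasurable
  · have := h.integral_resid
    rw [← hμ, integral_map hm.aemeasurable hr.aestronglyMeasurable] at this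
    exact this
  · exact indepFun_comp_of_map_eq hm hμ hr (by fun_prop) h.indepFun_resid
  · have := h.hasGaussianLaw_innov.isGaussian_map
    rw [← hμ, Measure.map_map ht hm] at this
    exact ⟨this⟩
  · have := h.integral_innov
    rw [← hμ, integral_map hm.aemeasurable ht.aestronglyMeasurable] at this
    exact this
  · exact indepFun_comp_of_map_eq hm hμ ht (by fun_prop) h.indepFun_innov

lemma condCov_prodMk (h : IsGaussianRegression P x y z A l ψ) (hx : Measurable x)
    (hy : Measurable y) (hz : Measurable z) (i j : Fin nx) :
    condCov P x (fun ω => (y ω, z ω)) i j =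
      ∫ ω, (x ω - (ψ (z ω) + A (y ω - l (z ω)))) i * (x ω - (ψ (z ω) + A (y ω - l (z ω)))) j ∂P := by
  have hl := h.measurable_l
  have hψ := h.measurable_ψ
  have hf := h.memLp_x.sub h.memLp_resid
  have := condCov_add_eq_of_indepFun (P := P) (w := fun ω => (y ω, z ω))
    (φ := fun p => ψ p.2 + A (p.1 - l p.2))
    (r := fun ω => x ω - (ψ (z ω) + A (y ω - l (z ω)))) (by fun_prop) (by fun_prop) (by fun_prop)
    (by simpa only [Pi.sub_def, sub_sub_cancel] using hf) h.memLp_resid h.integral_resid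
    h.indepFun_resid i j
  simpa only [add_sub_cancel] using this

/-- Given `z` the error of the best estimate is `A t + r`, and given `(y, z)` it is `r`. The two
terms are independent and centered, so the covariances subtract to that of `A t`. -/
lemma condCov_sub_condCov (h : IsGaussianRegression P x y z A l ψ) (hx : Measurable x)
    (hy : Measurable y) (hz : Measurable z) (i j : Fin nx) :
    (condCov P x z - condCov P x (fun ω => (y ω, z ω))) i j =
      ∫ ω, A (y ω - l (z ω)) i * A (y ω - l (z ω)) j ∂P := by
  have hl := h.measurable_l
  have hψ := h.measurable_ψ
  have hind : IndepFun (fun ω => (y ω - l (z ω), x ω - (ψ (z ω) + A (y ω - l (z ω))))) z P := by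
    have h1 : IndepFun z (fun ω => (y ω - l (z ω), x ω - (ψ (z ω) + A (y ω - l (z ω))))) P := by
      refine indepFun_prodMk_right hz (by fun_prop) (by fun_prop) h.indepFun_innov.symm ?_
      exact (h.indepFun_resid.comp measurable_id
        (ψ := fun p : Vec ny × Vec nz => (p.2, p.1 - l p.2)) (by fun_prop)).symm
    exact h1.symm
  have hψ2 : MemLp (fun ω => ψ (z ω)) 2 P := by
    have := (h.memLp_x.sub h.memLp_resid).sub h.memLp_innov
    simpa only [Pi.sub_def, sub_sub_cancel, add_sub_cancel_right] using this
  have hxz := condCov_add_eq_of_indepFun (P := P) (w := z) (φ := ψ)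
    (r := fun ω => A (y ω - l (z ω)) + (x ω - (ψ (z ω) + A (y ω - l (z ω)))))
    hz hψ (by fun_prop) hψ2 (h.memLp_innov.add h.memLp_resid)
    (by rw [integral_add (h.memLp_innov.integrable (by norm_num))
          (h.memLp_resid.integrable (by norm_num)), h.integral_comp_innov, h.integral_resid,
          add_zero])
    (hind.comp (φ := fun p : Vec ny × Vec nx => A p.1 + p.2) (by fun_prop) measurable_id) i j
  have e : (fun ω => ψ (z ω) + (A (y ω - l (z ω)) + (x ω - (ψ (z ω) + A (y ω - l (z ω)))))) = x := by
    ext1 ω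
    abel
  rw [e] at hxz
  rw [Matrix.sub_apply, hxz, h.condCov_prodMk hx hy hz, sub_eq_iff_eq_add]
  exact integral_add_mul_add_of_indepFun h.memLp_innov h.memLp_resid h.integral_resid
    (h.indepFun_resid.symm.comp (φ := fun p : Vec ny × Vec nz => A (p.1 - l p.2))
      (by fun_prop) measurable_id) i j

/-- Each auxiliary variable lives on its own sample space; this lemma and the next carry the
covariances of the source there. -/
lemma condCov_prodMk_of_map_eq {μ : Measure (Vec nx × Vec ny × Vec nz)} [IsProbabilityMeasure μ]
    (h : IsGaussianRegression μ (fun p => p.1) (fun p => p.2.1) (fun p => p.2.2) A l ψ)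
    (hx : Measurable x) (hy : Measurable y) (hz : Measurable z)
    (hμ : P.map (fun ω => (x ω, y ω, z ω)) = μ) :
    condCov P x (fun ω => (y ω, z ω)) = condCov μ (fun p => p.1) (fun p => (p.2.1, p.2.2)) := by
  have hl := h.measurable_l
  have hψ := h.measurable_ψ
  ext i j
  rw [(h.of_map_eq hx hy hz hμ).condCov_prodMk hx hy hz,
    h.condCov_prodMk (by fun_prop) (by fun_prop) (by fun_prop), ← hμ,
    integral_map (by fun_prop) (Measurable.aestronglyMeasurable (by fun_prop))]

lemma condCov_sub_condCov_of_map_eq {μ : Measure (Vec nx × Vec ny × Vec nz)}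
    [IsProbabilityMeasure μ]
    (h : IsGaussianRegression μ (fun p => p.1) (fun p => p.2.1) (fun p => p.2.2) A l ψ)
    (hx : Measurable x) (hy : Measurable y) (hz : Measurable z)
    (hμ : P.map (fun ω => (x ω, y ω, z ω)) = μ) :
    condCov P x z - condCov P x (fun ω => (y ω, z ω)) =
      condCov μ (fun p => p.1) (fun p => p.2.2) -
        condCov μ (fun p => p.1) (fun p => (p.2.1, p.2.2)) := by
  have hl := h.measurable_l
  have hψ := h.measurable_ψ
  ext i j
  rw [(h.of_map_eq hx hy hz hμ).condCov_sub_condCov hx hy hz,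
    h.condCov_sub_condCov (by fun_prop) (by fun_prop) (by fun_prop), ← hμ,
    integral_map (by fun_prop) (Measurable.aestronglyMeasurable (by fun_prop))]

lemma integral_mulVec_innov (h : IsGaussianRegression P x y z A l ψ) (hx : Measurable x)
    (hy : Measurable y) (hz : Measurable z) (W : Matrix (Fin nx) (Fin nx) ℝ) (i j : Fin nx) :
    ∫ ω, (W *ᵥ A (y ω - l (z ω))) i * (W *ᵥ A (y ω - l (z ω))) j ∂P =
      (W * (condCov P x z - condCov P x (fun ω => (y ω, z ω))) * Wᵀ) i j :=
  integral_mulVec_mul_mulVec h.memLp_innov W _ (h.condCov_sub_condCov hx hy hz) i j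

/-- The whitened innovation is a vector of independent standard Gaussian variables. -/
lemma map_mulVec_innov (h : IsGaussianRegression P x y z A l ψ) {W : Matrix (Fin nx) (Fin nx) ℝ}
    (hW : ∀ i j, ∫ ω, (W *ᵥ A (y ω - l (z ω))) i * (W *ᵥ A (y ω - l (z ω))) j ∂P =
      if i = j then 1 else 0) :
    HasGaussianLaw (fun ω => W *ᵥ A (y ω - l (z ω))) P ∧
    (∀ i, ∫ ω, (W *ᵥ A (y ω - l (z ω))) i ∂P = 0) ∧
    P.map (fun ω => W *ᵥ A (y ω - l (z ω))) = Measure.pi fun _ => gaussianReal 0 1 := by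
  let L : Vec ny →L[ℝ] (Fin nx → ℝ) := (Matrix.mulVecLin W).toContinuousLinearMap ∘L
    (EuclideanSpace.equiv (Fin nx) ℝ).toContinuousLinearMap ∘L A
  have hL : ∀ t, L t = W *ᵥ A t := fun t => rfl
  have hG : HasGaussianLaw (fun ω => W *ᵥ A (y ω - l (z ω))) P := h.hasGaussianLaw_innov.map_fun L
  have h0 : ∀ i, ∫ ω, (W *ᵥ A (y ω - l (z ω))) i ∂P = 0 := by
    intro i
    have := (ContinuousLinearMap.proj (R := ℝ) (φ := fun _ : Fin nx => ℝ) i ∘L L).integral_comp_comm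
      h.hasGaussianLaw_innov.integrable
    rw [h.integral_innov, map_zero] at this
    exact this
  refine ⟨hG, h0, ?_⟩
  have := map_eq_pi_gaussianReal hG h0 (v := fun _ => 1) hW
  simpa using this

end IsGaussianRegression

/-! ### Converse: lower bound for the rate -/

section Converse

variable {Ω : Type*} [MeasurableSpace Ω] {P : Measure Ω} [IsProbabilityMeasure P]

lemma integral_gaussianLogRatio {m : ℝ} {e k : Ω → ℝ} (he : MemLp e 2 P)
    (hk : MemLp (fun ω => e ω - k ω) 2 P) (he1 : ∫ ω, e ω * e ω ∂P = 1) :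
    Integrable (fun ω => gaussianLogRatio m (e ω) (k ω)) P ∧
      ∫ ω, gaussianLogRatio m (e ω) (k ω) ∂P =
        -(Real.log m / 2) - (∫ ω, (e ω - k ω) * (e ω - k ω) ∂P) / (2 * m) + 1 / 2 := by
  have h1 : Integrable (fun ω => e ω * e ω / 2) P := (he.integrable_mul he).div_const _
  have h2 : Integrable (fun ω => (e ω - k ω) * (e ω - k ω) / (2 * m)) P :=
    (hk.integrable_mul hk).div_const _
  have h3 : Integrable (fun ω => -(Real.log m / 2) - (e ω - k ω) * (e ω - k ω) / (2 * m)) P :=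
    (integrable_const _).sub h2
  simp only [gaussianLogRatio, pow_two]
  refine ⟨h3.add h1, ?_⟩
  rw [integral_add h3 h1, integral_sub (integrable_const _) h2, integral_div, integral_div, he1]
  simp

lemma condDistrib_ae_eq_map_add {nz ny : ℕ} {y : Ω → Vec ny} {z : Ω → Vec nz}
    {l : Vec nz → Vec ny} (hy : Measurable y) (hz : Measurable z) (hl : Measurable l)
    (h : IndepFun (fun ω => y ω - l (z ω)) z P) :
    ∀ᵐ a ∂(P.map z), condDistrib y z P a =
      (P.map fun ω => y ω - l (z ω)).map fun c => l a + c := by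
  have := condDistrib_ae_eq_map_of_indepFun (P := P) hz (by fun_prop) h.symm
    (G := fun p : Vec nz × Vec ny => l p.1 + p.2) (by fun_prop)
  simpa only [add_sub_cancel] using this

variable {n ny nz : ℕ} {U : Type*} [MeasurableSpace U] [StandardBorelSpace U] [Nonempty U]
  {y : Ω → Vec ny} {z : Ω → Vec nz} {u : Ω → U} {l : Vec nz → Vec ny} {e : Vec ny → Fin n → ℝ}
  {k : U × Vec nz → Fin n → ℝ} {m : Fin n → ℝ}

/-- Lower bound for the rate of an auxiliary variable that estimates independent standard
Gaussian variables with mean squared errors at most `m i`. -/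
lemma ofReal_le_condMutualInfo (hy : Measurable y) (hz : Measurable z) (hu : Measurable u)
    (hl : Measurable l) (he : Measurable e) (hk : Measurable k)
    (hind : IndepFun (fun ω => y ω - l (z ω)) z P)
    (hlaw : P.map (fun ω => e (y ω - l (z ω))) = Measure.pi fun _ => gaussianReal 0 1)
    (hm : ∀ i, 0 < m i) (he2 : ∀ i, MemLp (fun ω => e (y ω - l (z ω)) i) 2 P)
    (hone : ∀ i, ∫ ω, e (y ω - l (z ω)) i * e (y ω - l (z ω)) i ∂P = 1)
    (hk2 : ∀ i, MemLp (fun ω => e (y ω - l (z ω)) i - k (u ω, z ω) i) 2 P)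
    (herr : ∀ i, ∫ ω, (e (y ω - l (z ω)) i - k (u ω, z ω) i) *
      (e (y ω - l (z ω)) i - k (u ω, z ω) i) ∂P ≤ m i) :
    ENNReal.ofReal (∑ i, -(Real.log (m i) / 2)) ≤ RemoteSource.condMutualInfo P y u z := by
  let f : Vec nz × Vec ny × U → ℝ := fun p =>
    ∑ i, gaussianLogRatio (m i) (e (p.2.1 - l p.1) i) (k (p.2.2, p.1) i)
  have hf : Measurable f := by fun_prop
  have hmap : Measurable fun ω => (z ω, y ω, u ω) := by fun_prop
  have hP1 := Measure.isProbabilityMeasure_map hmap.aemeasurable (μ := P)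
  have hP2 := Measure.isProbabilityMeasure_map hz.aemeasurable (μ := P)
  have hlr := fun i => integral_gaussianLogRatio (m := m i) (he2 i) (hk2 i) (hone i)
  have hfi : Integrable (fun ω => f (z ω, y ω, u ω)) P :=
    integrable_finsetSum _ fun i _ => (hlr i).1
  have hQ : ∫⁻ p, ENNReal.ofReal (Real.exp (f p))
      ∂((P.map z) ⊗ₘ ((condDistrib y z P) ×ₖ (condDistrib u z P))) = 1 := by
    rw [Measure.lintegral_compProd (by fun_prop)]
    have : ∀ᵐ a ∂(P.map z), ∫⁻ p, ENNReal.ofReal (Real.exp (f (a, p)))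
        ∂(((condDistrib y z P) ×ₖ (condDistrib u z P)) a) = 1 := by
      filter_upwards [condDistrib_ae_eq_map_add hy hz hl hind] with a ha
      -- Integrating over `y` first, with `u` and `z` fixed, needs no knowledge of the law of `u`:
      -- the estimate `k` is then a constant and `e` is standard Gaussian.
      rw [Kernel.prod_apply, lintegral_prod_symm _ (by fun_prop)]
      have hin : ∀ b, ∫⁻ c, ENNReal.ofReal (Real.exp (f (a, c, b))) ∂(condDistrib y z P a) = 1 := by
        intro b
        rw [ha, lintegral_map (by fun_prop) (by fun_prop)]
        simp only [f, add_sub_cancel_left]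
        rw [lintegral_map (f := fun c => ENNReal.ofReal (Real.exp
          (∑ i, gaussianLogRatio (m i) (e c i) (k (b, a) i)))) (by fun_prop) (by fun_prop),
          ← lintegral_exp_sum_gaussianLogRatio hm (k (b, a)), ← hlaw,
          lintegral_map (by fun_prop) (by fun_prop)]
      simp [hin]
    rw [lintegral_congr_ae this]
    simp
  refine le_trans (ENNReal.ofReal_le_ofReal ?_) (ofReal_integral_le_klDiv hf
    ((integrable_map_measure hf.aestronglyMeasurable hmap.aemeasurable).2 hfi) hQ)
  rw [integral_map hmap.aemeasurable hf.aestronglyMeasurable,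
    integral_finsetSum _ fun i _ => (hlr i).1]
  refine Finset.sum_le_sum fun i _ => ?_
  rw [(hlr i).2]
  -- An error of at most `m i` makes the quadratic term at most `1 / 2`, the contribution of `E eᵢ²
  -- = 1`.
  have : (∫ ω, (e (y ω - l (z ω)) i - k (u ω, z ω) i) *
      (e (y ω - l (z ω)) i - k (u ω, z ω) i) ∂P) / (2 * m i) ≤ 1 / 2 := by
    rw [div_le_iff₀ (by linarith [hm i])]
    linarith [herr i]
  linarith

variable {nx : ℕ} {μ : Measure (Vec nx × Vec ny × Vec nz)} [IsProbabilityMeasure μ]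
  {A : Vec ny →L[ℝ] Vec nx} {ψ : Vec nz → Vec nx}

/-- With `g` the conditional mean of `x` given `(u, z)`, the vector `W (g - ψ z)` estimates the
whitened innovation, and the distortion constraint bounds its errors by `m`. -/
lemma IsGaussianRegression.ofReal_le_rate
    (h : IsGaussianRegression μ (fun p => p.1) (fun p => p.2.1) (fun p => p.2.2) A l ψ)
    {D W : Matrix (Fin nx) (Fin nx) ℝ} {m : Fin nx → ℝ} (hm : ∀ i, 0 < m i)
    (hW : W * (condCov μ (fun p => p.1) (fun p => p.2.2) -
        condCov μ (fun p => p.1) (fun p => (p.2.1, p.2.2))) * Wᵀ = 1)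
    (hW' : W * (D - condCov μ (fun p => p.1) (fun p => (p.2.1, p.2.2))) * Wᵀ = Matrix.diagonal m)
    (B : RemoteSource.AuxVar μ) (hD : (D - B.errorCov).PosSemidef) :
    ENNReal.ofReal (∑ i, -(Real.log (m i) / 2)) ≤ B.rate := by
  have hx := B.measurable_x
  have hy := B.measurable_y
  have hz := B.measurable_z
  have hu := B.measurable_u
  have hl := h.measurable_l
  have hψ := h.measurable_ψ
  have hB := h.of_map_eq hx hy hz B.law
  -- By the Markov chain the residual is independent not only of `(y, z)` but of `((y, z), u)`.
  have hres := indepFun_prodMk_of_condIndepFun (P := B.P) hu (hx.prodMk hz) hy B.markov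
    (r := fun p => p.2.1 - (ψ p.2.2 + A (p.1 - l p.2.2))) (s := fun p => (p.1, p.2.2))
    (q := fun p => p.1) (by fun_prop) (by fun_prop) (by fun_prop) (fun _ => rfl) hB.indepFun_resid
  obtain ⟨g, hg, hd, hcov⟩ := exists_condCov_add_eq (P := B.P)
    (φ := fun p : (Vec ny × Vec nz) × B.U => ψ p.1.2 + A (p.1.1 - l p.1.2))
    (v := fun ω => ((B.y ω, B.z ω), B.u ω))
    (r := fun ω => B.x ω - (ψ (B.z ω) + A (B.y ω - l (B.z ω)))) (q := fun p => (p.2, p.1.2))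
    (by fun_prop) (by fun_prop) (by fun_prop) (by fun_prop)
    (by simpa only [Pi.sub_def, sub_sub_cancel] using hB.memLp_x.sub hB.memLp_resid)
    hB.memLp_resid hB.integral_resid hres
  simp only [add_sub_cancel] at hcov
  have hW1 := hB.integral_mulVec_innov hx hy hz W
  rw [h.condCov_sub_condCov_of_map_eq hx hy hz B.law, hW] at hW1
  simp only [Matrix.one_apply] at hW1
  obtain ⟨hG, -, hlaw⟩ := hB.map_mulVec_innov hW1
  have hWd : ∀ ω i, (W *ᵥ A (B.y ω - l (B.z ω))) i -
      (W *ᵥ (g (B.u ω, B.z ω) - ψ (B.z ω))) i =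
      (W *ᵥ WithLp.ofLp (ψ (B.z ω) + A (B.y ω - l (B.z ω)) - g (B.u ω, B.z ω))) i := by
    intro ω i
    have hsub : (ψ (B.z ω) + A (B.y ω - l (B.z ω)) - g (B.u ω, B.z ω)).ofLp =
        (A (B.y ω - l (B.z ω))).ofLp - ((g (B.u ω, B.z ω)).ofLp - (ψ (B.z ω)).ofLp) := by
      ext j
      simp only [PiLp.sub_apply, PiLp.add_apply, Pi.sub_apply]
      ring
    rw [hsub]
    simp only [Matrix.mulVec_sub, Pi.sub_apply]
  have hmW : ∀ i, Measurable fun v : Vec nx => (W *ᵥ v) i := fun i => by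
    simp only [Matrix.mulVec, dotProduct]
    fun_prop
  have hmW' : Measurable fun v : Vec nx => W *ᵥ v := measurable_pi_iff.2 hmW
  have hmA : Measurable fun t : Vec ny => W *ᵥ A t := hmW'.comp (by fun_prop)
  have hmk : Measurable fun p : B.U × Vec nz => W *ᵥ (g p - ψ p.2) :=
    hmW'.comp (g := fun v : Vec nx => W *ᵥ v) (f := fun p : B.U × Vec nz => g p - ψ p.2)
      (by fun_prop)
  refine ofReal_le_condMutualInfo (P := B.P) (e := fun t => W *ᵥ A t)
    (k := fun p => W *ᵥ (g p - ψ p.2)) hy hz hu hl hmA hmk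
    hB.indepFun_innov hlaw hm (fun i => (hG.eval i).memLp_two)
    (fun i => by rw [hW1, if_pos rfl]) (fun i => ?_) (fun i => ?_)
  · simp only [hWd]
    simp only [Matrix.mulVec, dotProduct]
    exact memLp_finsetSum _ fun j _ => (RemoteSource.memLp_coord hd j).const_mul _
  · simp only [hWd]
    -- `C` is the covariance of the error in estimating `ψ z + A t`. Since `C ⪯ D - Σ_{x|yz}`, the
    -- diagonal of `W C Wᵀ` is at most `m`.
    set C : Matrix (Fin nx) (Fin nx) ℝ := B.errorCov - condCov B.P B.x (fun ω => (B.y ω, B.z ω))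
      with hC
    rw [integral_mulVec_mul_mulVec hd W C]
    · have h1 := (hD.mul_mul_transpose W).diag_nonneg (i := i)
      have h2 : D - B.errorCov =
          (D - condCov μ (fun p => p.1) (fun p => (p.2.1, p.2.2))) - C := by
        rw [hC, h.condCov_prodMk_of_map_eq hx hy hz B.law]
        abel
      rw [h2, Matrix.mul_sub, Matrix.sub_mul, hW', Matrix.sub_apply, Matrix.diagonal_apply_eq] at h1
      linarith
    · intro a b
      rw [hC, Matrix.sub_apply, hB.condCov_prodMk hx hy hz, RemoteSource.AuxVar.errorCov, hcov]
      ring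

end Converse

/-! ### The Gaussian test channel -/

section TestChannel

variable {Ω : Type*} [MeasurableSpace Ω] {P : Measure Ω} {n : ℕ}
  {N e : Ω → Fin n → ℝ}

lemma integral_mul_self_gaussianReal : ∫ x, x * x ∂(gaussianReal 0 1) = 1 := by
  have h := variance_eq_sub (μ := gaussianReal 0 1) (X := fun x : ℝ => x)
    (memLp_id_gaussianReal 2)
  rw [variance_fun_id_gaussianReal, integral_id_gaussianReal] at h
  simpa [pow_two] using h.symm

lemma map_coord_of_map_eq_pi (hN : Measurable N)
    (h : P.map N = Measure.pi fun _ => gaussianReal 0 1) (i : Fin n) :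
    P.map (fun ω => N ω i) = gaussianReal 0 1 := by
  rw [← (measurePreserving_eval (fun _ : Fin n => gaussianReal 0 1) i).map_eq, ← h,
    Measure.map_map (by fun_prop) hN]
  rfl

lemma integral_coord_of_map_eq_pi (hN : Measurable N)
    (h : P.map N = Measure.pi fun _ => gaussianReal 0 1) (i : Fin n) :
    ∫ ω, N ω i ∂P = 0 := by
  have := integral_map (μ := P) (φ := fun ω => N ω i) (by fun_prop) (f := fun x : ℝ => x)
    (by fun_prop)
  rw [← this, map_coord_of_map_eq_pi hN h, integral_id_gaussianReal]

lemma hasGaussianLaw_of_map_eq_pi (h : P.map N = Measure.pi fun _ => gaussianReal 0 1) : HasGaussianLaw N P := by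
  have hpi : IsGaussian (Measure.pi fun _ : Fin n => gaussianReal 0 1) := by
    have h1 : iIndepFun (fun i (x : Fin n → ℝ) => x i)
        (Measure.pi fun _ : Fin n => gaussianReal 0 1) :=
      iIndepFun_pi (μ := fun _ : Fin n => gaussianReal 0 1) (X := fun _ (x : ℝ) => x)
        (fun _ => (measurable_id (α := ℝ)).aemeasurable)
    have h2 : ∀ i : Fin n, HasGaussianLaw (fun x : Fin n → ℝ => x i)
        (Measure.pi fun _ : Fin n => gaussianReal 0 1) := fun i => by
      refine ⟨?_⟩
      have := map_coord_of_map_eq_pi (P := Measure.pi fun _ : Fin n => gaussianReal 0 1)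
        (N := fun x => x) (by fun_prop) Measure.map_id i
      rw [this]
      infer_instance
    have := (iIndepFun.hasGaussianLaw h2 h1).isGaussian_map
    rwa [show (fun (x : Fin n → ℝ) (i : Fin n) => x i) = id from rfl, Measure.map_id] at this
  exact ⟨h ▸ hpi⟩

variable [IsProbabilityMeasure P]

lemma integral_mul_of_map_eq_pi (hN : Measurable N)
    (h : P.map N = Measure.pi fun _ => gaussianReal 0 1) (i j : Fin n) :
    ∫ ω, N ω i * N ω j ∂P = if i = j then 1 else 0 := by
  split_ifs with hij
  · subst hij
    have := integral_map (μ := P) (φ := fun ω => N ω i) (by fun_prop) (f := fun x : ℝ => x * x)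
      (by fun_prop)
    rw [← this, map_coord_of_map_eq_pi hN h, integral_mul_self_gaussianReal]
  · have h1 : iIndepFun (fun i ω => N ω i) P := by
      rw [iIndepFun_iff_map_fun_eq_pi_map (by fun_prop)]
      simp only [map_coord_of_map_eq_pi hN h]
      exact h
    rw [(h1.indepFun hij).integral_fun_mul_eq_mul_integral (by fun_prop) (by fun_prop),
      integral_coord_of_map_eq_pi hN h, zero_mul]

variable (he : Measurable e) (hN : Measurable N)
  (helaw : P.map e = Measure.pi fun _ => gaussianReal 0 1)
  (hNlaw : P.map N = Measure.pi fun _ => gaussianReal 0 1) (heN : IndepFun e N P)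

include he hN helaw hNlaw heN

lemma integral_linComb_mul_linComb (i j : Fin n) (a b c d : ℝ) :
    ∫ ω, (a * e ω i + b * N ω i) * (c * e ω j + d * N ω j) ∂P =
      if i = j then a * c + b * d else 0 := by
  have hI : ∀ {a b : Ω → ℝ}, MemLp a 2 P → MemLp b 2 P → Integrable (fun ω => a ω * b ω) P :=
    fun ha hb => ha.integrable_mul hb
  have m1 := fun i => ((hasGaussianLaw_of_map_eq_pi helaw).eval i).memLp_two
  have m2 := fun i => ((hasGaussianLaw_of_map_eq_pi hNlaw).eval i).memLp_two
  have hcross : ∀ i j, ∫ ω, e ω i * N ω j ∂P = 0 := by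
    intro i j
    exact (IndepFun.integral_fun_mul_eq_mul_integral (heN.comp (φ := fun v : Fin n → ℝ => v i)
      (ψ := fun v : Fin n → ℝ => v j) (by fun_prop) (by fun_prop)) (m1 i).1 (m2 j).1).trans
      (mul_eq_zero_of_right _ (integral_coord_of_map_eq_pi hN hNlaw j))
  have h1 := (hI (m1 i) (m1 j)).const_mul (a * c)
  have h2 := (hI (m2 i) (m2 j)).const_mul (b * d)
  have h3 := (hI (m1 i) (m2 j)).const_mul (a * d)
  have h4 := (hI (m1 j) (m2 i)).const_mul (b * c)
  have hexp : ∀ ω, (a * e ω i + b * N ω i) * (c * e ω j + d * N ω j) =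
      (a * c * (e ω i * e ω j) + b * d * (N ω i * N ω j)) +
        (a * d * (e ω i * N ω j) + b * c * (e ω j * N ω i)) := fun ω => by ring
  simp only [hexp]
  rw [integral_add (by exact h1.add h2) (by exact h3.add h4), integral_add h1 h2,
    integral_add h3 h4, integral_const_mul, integral_const_mul, integral_const_mul,
    integral_const_mul, hcross, hcross, integral_mul_of_map_eq_pi he helaw,
    integral_mul_of_map_eq_pi hN hNlaw]
  split_ifs <;> ring

omit [IsProbabilityMeasure P] heN in
lemma integral_linComb (i : Fin n) (a b : ℝ) : ∫ ω, (a * e ω i + b * N ω i) ∂P = 0 := by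
  have m1 := ((hasGaussianLaw_of_map_eq_pi helaw).eval i).integrable
  have m2 := ((hasGaussianLaw_of_map_eq_pi hNlaw).eval i).integrable
  rw [integral_add (m1.const_mul a) (m2.const_mul b), integral_const_mul, integral_const_mul,
    integral_coord_of_map_eq_pi he helaw, integral_coord_of_map_eq_pi hN hNlaw]
  simp

omit [IsProbabilityMeasure P] he hN in
lemma hasGaussianLaw_linComb (a b c d : Fin n → ℝ) :
    HasGaussianLaw (fun ω => ((fun i => a i * e ω i + b i * N ω i),
      (fun i => c i * e ω i + d i * N ω i))) P := by
  have h := IndepFun.hasGaussianLaw (hasGaussianLaw_of_map_eq_pi helaw)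
    (hasGaussianLaw_of_map_eq_pi hNlaw) heN
  let L : (Fin n → ℝ) × (Fin n → ℝ) →L[ℝ] (Fin n → ℝ) × (Fin n → ℝ) :=
    LinearMap.toContinuousLinearMap
      { toFun := fun p => ((fun i => a i * p.1 i + b i * p.2 i),
          (fun i => c i * p.1 i + d i * p.2 i))
        map_add' := fun p q => by ext i <;> simp <;> ring
        map_smul' := fun k p => by ext i <;> simp <;> ring }
  exact h.map_fun L

variable {m : Fin n → ℝ} (hm : ∀ i, 0 < m i) (hm1 : ∀ i, m i ≤ 1)

include hm hm1

/-- The variances add up: `(1 - m)² + m (1 - m) = 1 - m`. -/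
lemma map_testChannel :
    P.map (fun ω i => (1 - m i) * e ω i + √(m i * (1 - m i)) * N ω i) =
      Measure.pi fun i => gaussianReal 0 (1 - m i).toNNReal := by
  have h := (hasGaussianLaw_linComb helaw hNlaw heN (fun i => 1 - m i)
    (fun i => √(m i * (1 - m i))) 0 0).fst
  refine map_eq_pi_gaussianReal h
    (fun i => integral_linComb he hN helaw hNlaw i _ _) fun i j => ?_
  rw [integral_linComb_mul_linComb he hN helaw hNlaw heN]
  split_ifs with hij
  · subst hij
    rw [Real.mul_self_sqrt (mul_nonneg (hm i).le (by linarith [hm1 i]))]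
    ring
  · rfl

/-- The first vector is `e - v`, with `v` the channel output. Its covariance with `v` is `m (1 - m)
- m (1 - m) = 0`, so `e` is `v` plus independent noise. -/
lemma indepFun_testChannel :
    IndepFun (fun ω i => m i * e ω i + -√(m i * (1 - m i)) * N ω i)
      (fun ω i => (1 - m i) * e ω i + √(m i * (1 - m i)) * N ω i) P := by
  have h := hasGaussianLaw_linComb helaw hNlaw heN m
    (fun i => -√(m i * (1 - m i))) (fun i => 1 - m i) (fun i => √(m i * (1 - m i)))
  refine HasGaussianLaw.indepFun_of_covariance_eval
    (X := fun i ω => m i * e ω i + -√(m i * (1 - m i)) * N ω i)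
    (Y := fun i ω => (1 - m i) * e ω i + √(m i * (1 - m i)) * N ω i) h fun i j => ?_
  rw [covariance_eq_sub (h.fst.eval i).memLp_two (h.snd.eval j).memLp_two]
  have h1 := integral_linComb_mul_linComb he hN helaw hNlaw heN i j (m i) (-√(m i * (1 - m i)))
    (1 - m j) (√(m j * (1 - m j)))
  have h2 := integral_linComb he hN helaw hNlaw i (m i) (-√(m i * (1 - m i)))
  simp only [Pi.mul_apply]
  rw [h1, h2, zero_mul, sub_zero]
  split_ifs with hij
  · subst hij
    rw [neg_mul, Real.mul_self_sqrt (mul_nonneg (hm i).le (by linarith [hm1 i]))]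
    ring
  · rfl

omit [IsProbabilityMeasure P] he hN helaw hNlaw heN in
-- Change of measure from the output law given `e = c` to the marginal output law; the density is
-- the forward reading of the Gaussian ratio.
lemma lintegral_testChannel (c : Fin n → ℝ) {F : (Fin n → ℝ) → ℝ≥0∞} (hF : Measurable F) :
    ∫⁻ b, F (fun i => (1 - m i) * c i + √(m i * (1 - m i)) * b i)
        ∂(Measure.pi fun _ => gaussianReal 0 1) =
      ∫⁻ b, ENNReal.ofReal (Real.exp (∑ i, gaussianLogRatio (m i) (c i) (b i))) * F b
        ∂(Measure.pi fun i => gaussianReal 0 (1 - m i).toNNReal) := by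
  have h1 : ∀ i, (gaussianReal 0 1).map (fun x => (1 - m i) * c i + √(m i * (1 - m i)) * x) =
      gaussianReal ((1 - m i) * c i) (m i * (1 - m i)).toNNReal := by
    intro i
    have : (fun x => (1 - m i) * c i + √(m i * (1 - m i)) * x) =
        (fun x => (1 - m i) * c i + x) ∘ fun x => √(m i * (1 - m i)) * x := rfl
    rw [this, ← Measure.map_map (by fun_prop) (by fun_prop), gaussianReal_map_const_mul,
      gaussianReal_map_const_add, mul_zero, zero_add, mul_one]
    congr 1
    ext
    have h0 : 0 ≤ m i * (1 - m i) := mul_nonneg (hm i).le (by linarith [hm1 i])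
    rw [Real.coe_toNNReal _ h0]
    exact Real.sq_sqrt h0
  have h2 : (Measure.pi fun _ : Fin n => gaussianReal 0 1).map
      (fun b i => (1 - m i) * c i + √(m i * (1 - m i)) * b i) =
      Measure.pi fun i => gaussianReal ((1 - m i) * c i) (m i * (1 - m i)).toNNReal := by
    have : ∀ i, SigmaFinite ((gaussianReal 0 1).map
        (fun x => (1 - m i) * c i + √(m i * (1 - m i)) * x)) := fun i => by
      rw [h1 i]; infer_instance
    rw [Measure.pi_map_pi (f := fun i x => (1 - m i) * c i + √(m i * (1 - m i)) * x)
      (by fun_prop)]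
    simp only [h1]
  have h3 := lintegral_map (μ := Measure.pi fun _ : Fin n => gaussianReal 0 1) hF
    (g := fun b i => (1 - m i) * c i + √(m i * (1 - m i)) * b i) (by fun_prop)
  rw [← h3, h2, ← pi_gaussianReal_withDensity_gaussianLogRatio hm hm1,
    lintegral_withDensity_eq_lintegral_mul _ (by fun_prop) hF]
  rfl

end TestChannel

/-! ### Rate of the test channel -/

section Achievability

variable {Ω : Type*} [MeasurableSpace Ω] {P : Measure Ω} [IsProbabilityMeasure P] {n ny nz : ℕ}
  {y : Ω → Vec ny} {z : Ω → Vec nz} {N : Ω → Fin n → ℝ} {l : Vec nz → Vec ny}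
  {e : Vec ny → Fin n → ℝ} {s : Vec nz → Fin n → ℝ} {m : Fin n → ℝ}

/-- The rate of the Gaussian test channel. -/
lemma condMutualInfo_testChannel (hy : Measurable y) (hz : Measurable z) (hN : Measurable N)
    (hl : Measurable l) (he : Measurable e) (hs : Measurable s)
    (hind : IndepFun (fun ω => y ω - l (z ω)) z P)
    (hNind : IndepFun (fun ω => (z ω, y ω - l (z ω))) N P)
    (helaw : P.map (fun ω => e (y ω - l (z ω))) = Measure.pi fun _ => gaussianReal 0 1)
    (hNlaw : P.map N = Measure.pi fun _ => gaussianReal 0 1)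
    (hm : ∀ i, 0 < m i) (hm1 : ∀ i, m i ≤ 1) :
    RemoteSource.condMutualInfo P y (fun ω i => s (z ω) i +
      ((1 - m i) * e (y ω - l (z ω)) i + √(m i * (1 - m i)) * N ω i)) z =
      ENNReal.ofReal (∑ i, -(Real.log (m i) / 2)) := by
  set t : Ω → Vec ny := fun ω => y ω - l (z ω) with ht
  have htm : Measurable t := by fun_prop
  set v : Ω → Fin n → ℝ := fun ω i => (1 - m i) * e (t ω) i + √(m i * (1 - m i)) * N ω i with hv
  have hvm : Measurable v := by fun_prop
  have htN : IndepFun t N P := hNind.comp measurable_snd measurable_id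
  have heN : IndepFun (fun ω => e (t ω)) N P := htN.comp he measurable_id
  have hem : Measurable fun ω => e (t ω) := by fun_prop
  have hztN : IndepFun z (fun ω => (t ω, N ω)) P :=
    indepFun_prodMk_right hz htm hN hind.symm hNind
  have hzv : IndepFun z v P := hztN.comp (ψ := fun p : Vec ny × (Fin n → ℝ) => fun i =>
    (1 - m i) * e p.1 i + √(m i * (1 - m i)) * p.2 i) measurable_id (by fun_prop)
  have hvlaw : P.map v = Measure.pi fun i => gaussianReal 0 (1 - m i).toNNReal :=
    map_testChannel hem hN helaw hNlaw heN hm hm1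
  set u : Ω → Fin n → ℝ := fun ω i => s (z ω) i + v ω i with hu
  have hum : Measurable u := by fun_prop
  have hP2 := Measure.isProbabilityMeasure_map hz.aemeasurable (μ := P)
  have hmap : Measurable fun ω => (z ω, y ω, u ω) := by fun_prop
  have hP1 := Measure.isProbabilityMeasure_map hmap.aemeasurable (μ := P)
  -- The function of the converse, with `u - s z = v` as the estimate of `e`.
  let f : Vec nz × Vec ny × (Fin n → ℝ) → ℝ := fun p =>
    ∑ i, gaussianLogRatio (m i) (e (p.2.1 - l p.1) i) (p.2.2 i - s p.1 i)
  have hf : Measurable f := by fun_prop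
  have hdens : P.map (fun ω => (z ω, y ω, u ω)) =
      ((P.map z) ⊗ₘ ((condDistrib y z P) ×ₖ (condDistrib u z P))).withDensity
        fun p => ENNReal.ofReal (Real.exp (f p)) := by
    refine Measure.ext_of_lintegral _ fun F hF => ?_
    rw [lintegral_withDensity_eq_lintegral_mul _ (by fun_prop) hF,
      Measure.lintegral_compProd (by fun_prop)]
    have hcu := condDistrib_ae_eq_map_of_indepFun (P := P) hz hvm hzv
      (G := fun p : Vec nz × (Fin n → ℝ) => fun i => s p.1 i + p.2 i) (by fun_prop)
    -- Given `z = a`, the weight `exp f` turns the independent copy of `v` into the actual channel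
    -- output for the input `e (t ω)`.
    have hQ : ∀ᵐ a ∂(P.map z), ∫⁻ p, ((fun p => ENNReal.ofReal (Real.exp (f p))) * F) (a, p)
        ∂(((condDistrib y z P) ×ₖ (condDistrib u z P)) a) =
        ∫⁻ ω, ∫⁻ b, F (a, l a + t ω, fun i => s a i +
          ((1 - m i) * e (t ω) i + √(m i * (1 - m i)) * b i))
          ∂(Measure.pi fun _ => gaussianReal 0 1) ∂P := by
      filter_upwards [condDistrib_ae_eq_map_add hy hz hl hind, hcu] with a ha hb
      rw [Kernel.prod_apply, lintegral_prod _ (by fun_prop), ha,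
        lintegral_map (Measurable.lintegral_prod_right' (f := fun p : Vec ny × (Fin n → ℝ) =>
          ((fun p => ENNReal.ofReal (Real.exp (f p))) * F) (a, p)) (by fun_prop)) (by fun_prop),
        lintegral_map (Measurable.lintegral_prod_right' (f := fun p : Vec ny × (Fin n → ℝ) =>
          ((fun p => ENNReal.ofReal (Real.exp (f p))) * F) (a, l a + p.1, p.2)) (by fun_prop)) htm]
      refine lintegral_congr fun ω => ?_
      rw [hb, lintegral_map (by fun_prop) (by fun_prop), hvlaw,
        lintegral_testChannel hm hm1 (e (t ω))
          (F := fun b => F (a, l a + t ω, fun i => s a i + b i)) (by fun_prop)]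
      refine lintegral_congr fun b => ?_
      simp only [Pi.mul_apply, f, add_sub_cancel_left]
    rw [lintegral_congr_ae hQ, lintegral_map hF hmap, lintegral_map ?_ hz]
    · have hyt : ∀ ω, y ω = l (z ω) + t ω := fun ω => by simp [ht]
      have h1 := lintegral_comp_prodMk_of_indepFun (P := P) hz (by fun_prop) hztN
        (F := fun p : Vec nz × Vec ny × (Fin n → ℝ) => F (p.1, l p.1 + p.2.1, fun i => s p.1 i +
          ((1 - m i) * e p.2.1 i + √(m i * (1 - m i)) * p.2.2 i))) (by fun_prop)
      simp only [← hyt] at h1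
      refine h1.trans (lintegral_congr fun ω => ?_)
      have h2 := lintegral_comp_prodMk_of_indepFun (P := P) htm hN htN
        (F := fun p : Vec ny × (Fin n → ℝ) => F (z ω, l (z ω) + p.1, fun i => s (z ω) i +
          ((1 - m i) * e p.1 i + √(m i * (1 - m i)) * p.2 i))) (by fun_prop)
      refine h2.trans (lintegral_congr fun ω' => ?_)
      rw [← hNlaw, lintegral_map (by fun_prop) hN]
    · exact Measurable.lintegral_prod_right' (f := fun q : Vec nz × Ω => ∫⁻ b, F (q.1, l q.1 + t q.2,
        fun i => s q.1 i + ((1 - m i) * e (t q.2) i + √(m i * (1 - m i)) * b i))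
        ∂(Measure.pi fun _ => gaussianReal 0 1))
        (Measurable.lintegral_prod_right' (f := fun q : (Vec nz × Ω) × (Fin n → ℝ) =>
          F (q.1.1, l q.1.1 + t q.1.2, fun i => s q.1.1 i +
            ((1 - m i) * e (t q.1.2) i + √(m i * (1 - m i)) * q.2 i))) (by fun_prop))
  have hG := hasGaussianLaw_linComb helaw hNlaw heN m
    (fun i => -√(m i * (1 - m i))) (fun i => 1 - m i) (fun i => √(m i * (1 - m i)))
  have herr : ∀ ω i, e (t ω) i - v ω i = m i * e (t ω) i + -√(m i * (1 - m i)) * N ω i :=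
    fun ω i => by simp only [hv]; ring
  have hlr := fun i => integral_gaussianLogRatio (P := P) (m := m i) (e := fun ω => e (t ω) i)
    (k := fun ω => v ω i) ((hasGaussianLaw_of_map_eq_pi helaw).eval i).memLp_two
    (by simp only [herr]; exact (hG.fst.eval i).memLp_two)
    (by rw [integral_mul_of_map_eq_pi hem helaw, if_pos rfl])
  have hfu : ∀ ω, f (z ω, y ω, u ω) = ∑ i, gaussianLogRatio (m i) (e (t ω) i) (v ω i) :=
    fun ω => by simp only [f, hu, add_sub_cancel_left, ht]
  have hfi : Integrable (fun ω => f (z ω, y ω, u ω)) P := by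
    simp only [hfu]
    exact integrable_finsetSum _ fun i _ => (hlr i).1
  refine (klDiv_withDensity_exp hf hdens
    ((integrable_map_measure hf.aestronglyMeasurable hmap.aemeasurable).2 hfi)).trans ?_
  congr 1
  rw [integral_map hmap.aemeasurable hf.aestronglyMeasurable]
  simp only [hfu]
  rw [integral_finsetSum _ fun i _ => (hlr i).1]
  refine Finset.sum_congr rfl fun i _ => ?_
  rw [(hlr i).2]
  simp only [herr]
  rw [integral_linComb_mul_linComb hem hN helaw hNlaw heN, if_pos rfl, neg_mul_neg,
    Real.mul_self_sqrt (mul_nonneg (hm i).le (by linarith [hm1 i]))]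
  have := (hm i).ne'
  field_simp
  ring

end Achievability

/-! ### Error covariance of the test channel and an optimal auxiliary variable -/

lemma measurable_mulVec_ofLp {k n : ℕ} (W : Matrix (Fin k) (Fin n) ℝ) :
    Measurable fun v : Vec n => W *ᵥ v := measurable_pi_iff.2 fun i => by
  simp only [Matrix.mulVec, dotProduct]
  fun_prop

/-- The total error is built from `r` and `ν = e - v`, while the decoder knows `(v, z)`.
Contraction, applied to `ν` and `v`, then `z`, then `r`, separates the two pairs. -/
lemma indepFun_testChannel_prodMk {Ω α β : Type*} [MeasurableSpace Ω] [MeasurableSpace α]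
    [MeasurableSpace β] {P : Measure Ω} [IsProbabilityMeasure P] {n : ℕ} {r : Ω → α} {z : Ω → β}
    {e N : Ω → Fin n → ℝ} {m : Fin n → ℝ} (hr : Measurable r) (hz : Measurable z)
    (he : Measurable e) (hN : Measurable N)
    (helaw : P.map e = Measure.pi fun _ => gaussianReal 0 1)
    (hNlaw : P.map N = Measure.pi fun _ => gaussianReal 0 1)
    (hze : IndepFun z e P) (hrez : IndepFun r (fun ω => (e ω, z ω)) P)
    (hall : IndepFun (fun ω => (r ω, e ω, z ω)) N P) (hm : ∀ i, 0 < m i) (hm1 : ∀ i, m i ≤ 1) :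
    IndepFun (fun ω => ((fun i => (1 - m i) * e ω i + √(m i * (1 - m i)) * N ω i), z ω))
      (fun ω => ((fun i => m i * e ω i + -√(m i * (1 - m i)) * N ω i), r ω)) P ∧
    IndepFun r (fun ω i => m i * e ω i + -√(m i * (1 - m i)) * N ω i) P := by
  have heN : IndepFun e N P :=
    hall.comp (φ := fun p : α × (Fin n → ℝ) × β => p.2.1) (by fun_prop) measurable_id
  have hνv := indepFun_testChannel he hN helaw hNlaw heN hm hm1
  have hzeN : IndepFun z (fun ω => (e ω, N ω)) P := indepFun_prodMk_right hz he hN hze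
    (hall.comp (φ := fun p : α × (Fin n → ℝ) × β => (p.2.2, p.2.1)) (by fun_prop) measurable_id)
  have hνvz := indepFun_prodMk_right (by fun_prop) (by fun_prop) hz hνv (hzeN.symm.comp
    (φ := fun p : (Fin n → ℝ) × (Fin n → ℝ) =>
      ((fun i => m i * p.1 i + -√(m i * (1 - m i)) * p.2 i),
        (fun i => (1 - m i) * p.1 i + √(m i * (1 - m i)) * p.2 i))) (by fun_prop) measurable_id)
  have hrN : IndepFun r (fun ω => ((e ω, z ω), N ω)) P :=
    indepFun_prodMk_right hr (by fun_prop) hN hrez hall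
  refine ⟨?_, hrN.comp (ψ := fun q : ((Fin n → ℝ) × β) × (Fin n → ℝ) =>
    fun i => m i * q.1.1 i + -√(m i * (1 - m i)) * q.2 i) measurable_id (by fun_prop)⟩
  exact indepFun_prodMk_right (by fun_prop) (by fun_prop) hr hνvz.symm (hrN.comp
    (ψ := fun q : ((Fin n → ℝ) × β) × (Fin n → ℝ) =>
      (((fun i => (1 - m i) * q.1.1 i + √(m i * (1 - m i)) * q.2 i), q.1.2),
        (fun i => m i * q.1.1 i + -√(m i * (1 - m i)) * q.2 i)))
      measurable_id (by fun_prop)).symm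

namespace IsGaussianRegression

variable {nx ny nz : ℕ} {A : Vec ny →L[ℝ] Vec nx} {l : Vec nz → Vec ny} {ψ : Vec nz → Vec nx}

/-- The error covariance of the Gaussian test channel. -/
lemma condCov_testChannel {Ω : Type*} [MeasurableSpace Ω] {P : Measure Ω} [IsProbabilityMeasure P]
    {x : Ω → Vec nx} {y : Ω → Vec ny} {z : Ω → Vec nz} {N : Ω → Fin nx → ℝ}
    (h : IsGaussianRegression P x y z A l ψ) (hx : Measurable x) (hy : Measurable y)
    (hz : Measurable z) (hN : Measurable N)
    (hNind : IndepFun (fun ω => (x ω, y ω, z ω)) N P)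
    (hNlaw : P.map N = Measure.pi fun _ => gaussianReal 0 1)
    {W D : Matrix (Fin nx) (Fin nx) ℝ} {m : Fin nx → ℝ} {s : Vec nz → Fin nx → ℝ}
    (hs : Measurable s) (hm : ∀ i, 0 < m i) (hm1 : ∀ i, m i ≤ 1) (hWu : IsUnit W)
    (hW : W * (condCov P x z - condCov P x (fun ω => (y ω, z ω))) * Wᵀ = 1)
    (hW' : W * (D - condCov P x (fun ω => (y ω, z ω))) * Wᵀ = Matrix.diagonal m) :
    condCov P x (fun ω => ((fun i => s (z ω) i + ((1 - m i) * (W *ᵥ A (y ω - l (z ω))) i +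
      √(m i * (1 - m i)) * N ω i)), z ω)) = D := by
  have hl := h.measurable_l
  have hψ := h.measurable_ψ
  have hW1 := h.integral_mulVec_innov hx hy hz W
  rw [hW] at hW1
  simp only [Matrix.one_apply] at hW1
  obtain ⟨-, -, helaw⟩ := h.map_mulVec_innov hW1
  have hmA : Measurable fun t : Vec ny => W *ᵥ A t :=
    (measurable_mulVec_ofLp W).comp (g := fun v : Vec nx => W *ᵥ v) (f := fun t => A t)
      (by fun_prop)
  have hmt : Measurable fun p : Vec nx × Vec ny × Vec nz => p.2.1 - l p.2.2 := by fun_prop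
  have hmt' : Measurable fun p : Vec ny × Vec nz => p.1 - l p.2 := by fun_prop
  have hmr : Measurable fun p : Vec nx × Vec ny × Vec nz =>
    p.1 - (ψ p.2.2 + A (p.2.1 - l p.2.2)) := by fun_prop
  have hem : Measurable fun ω => W *ᵥ A (y ω - l (z ω)) :=
    hmA.comp (g := fun t : Vec ny => W *ᵥ A t) (f := fun ω => y ω - l (z ω)) (by fun_prop)
  have hze : IndepFun z (fun ω => W *ᵥ A (y ω - l (z ω))) P :=
    h.indepFun_innov.symm.comp (ψ := fun t : Vec ny => W *ᵥ A t) measurable_id hmA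
  have hrez : IndepFun (fun ω => x ω - (ψ (z ω) + A (y ω - l (z ω))))
      (fun ω => (W *ᵥ A (y ω - l (z ω)), z ω)) P :=
    h.indepFun_resid.comp (ψ := fun p : Vec ny × Vec nz => (W *ᵥ A (p.1 - l p.2), p.2))
      measurable_id ((hmA.comp hmt').prodMk measurable_snd)
  have hall : IndepFun (fun ω => (x ω - (ψ (z ω) + A (y ω - l (z ω))),
      W *ᵥ A (y ω - l (z ω)), z ω)) N P :=
    hNind.comp (φ := fun p : Vec nx × Vec ny × Vec nz =>
      (p.1 - (ψ p.2.2 + A (p.2.1 - l p.2.2)), W *ᵥ A (p.2.1 - l p.2.2), p.2.2))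
      (hmr.prodMk ((hmA.comp hmt).prodMk (measurable_snd.comp measurable_snd))) measurable_id
  have hrm : Measurable fun ω => x ω - (ψ (z ω) + A (y ω - l (z ω))) := by fun_prop
  obtain ⟨hνr, hrν⟩ := indepFun_testChannel_prodMk hrm hz hem hN helaw hNlaw hze hrez hall hm hm1
  have heN : IndepFun (fun ω => W *ᵥ A (y ω - l (z ω))) N P := hall.comp
    (φ := fun p : Vec nx × (Fin nx → ℝ) × Vec nz => p.2.1) (by fun_prop) measurable_id
  obtain ⟨e, he⟩ : ∃ e : Ω → Fin nx → ℝ, ∀ ω, W *ᵥ A (y ω - l (z ω)) = e ω := ⟨_, fun _ => rfl⟩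
  obtain ⟨r, hr⟩ : ∃ r : Ω → Vec nx, ∀ ω, x ω - (ψ (z ω) + A (y ω - l (z ω))) = r ω :=
    ⟨_, fun _ => rfl⟩
  have hr2 := h.memLp_resid
  have hr0 := h.integral_resid
  have hrr := h.condCov_prodMk hx hy hz
  simp only [he, hr] at helaw hem hrm hνr hrν heN hr2 hr0 hrr ⊢
  obtain ⟨v, hv⟩ : ∃ v : Ω → Fin nx → ℝ,
    v = fun ω i => (1 - m i) * e ω i + √(m i * (1 - m i)) * N ω i := ⟨_, rfl⟩
  obtain ⟨ν, hν⟩ : ∃ ν : Ω → Fin nx → ℝ,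
    ν = fun ω i => m i * e ω i + -√(m i * (1 - m i)) * N ω i := ⟨_, rfl⟩
  have hvω : ∀ ω, (fun i => (1 - m i) * e ω i + √(m i * (1 - m i)) * N ω i) = v ω :=
    fun ω => by rw [hv]
  have hvi : ∀ ω i, (1 - m i) * e ω i + √(m i * (1 - m i)) * N ω i = v ω i :=
    fun ω i => by rw [hv]
  have hνω : ∀ ω, (fun i => m i * e ω i + -√(m i * (1 - m i)) * N ω i) = ν ω :=
    fun ω => by rw [hν]
  have hvm : Measurable v := by rw [hv]; fun_prop
  have hνm : Measurable ν := by rw [hν]; fun_prop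
  simp only [hνω, hvω] at hνr
  rw [← hν] at hrν
  simp only [hvi]
  -- `L` is `W⁻¹`: it undoes the whitening, so that `A t = L v + L ν`.
  let L : (Fin nx → ℝ) →L[ℝ] Vec nx := (EuclideanSpace.equiv (Fin nx) ℝ).symm.toContinuousLinearMap
    ∘L (Matrix.mulVecLin W⁻¹).toContinuousLinearMap
  have hLapp : ∀ a i, L a i = (W⁻¹ *ᵥ a) i := fun a i => rfl
  have hLW : ∀ a : Vec nx, L (W *ᵥ a) = a := by
    intro a
    ext i
    rw [hLapp, Matrix.mulVec_mulVec,
      Matrix.nonsing_inv_mul _ ((Matrix.isUnit_iff_isUnit_det W).1 hWu), Matrix.one_mulVec]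
  obtain ⟨b, hb⟩ : ∃ b : Ω → Vec nx, b = fun ω => L (ν ω) := ⟨_, rfl⟩
  have hbm : Measurable b := by rw [hb]; fun_prop
  have hind : IndepFun (fun ω => r ω + b ω)
      (fun ω => ((fun i => s (z ω) i + v ω i), z ω)) P := by
    rw [hb]
    exact (hνr.comp (φ := fun p : (Fin nx → ℝ) × Vec nz => ((fun i => s p.2 i + p.1 i), p.2))
      (ψ := fun p : (Fin nx → ℝ) × Vec nx => p.2 + L p.1) (by fun_prop) (by fun_prop)).symm
  have hrb : IndepFun r b P := by
    rw [hb]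
    exact hrν.comp (ψ := L) measurable_id (by fun_prop)
  have hνG : HasGaussianLaw ν P := by
    rw [hν]
    exact (hasGaussianLaw_linComb helaw hNlaw heN m (fun i => -√(m i * (1 - m i))) 0 0).fst
  have hb2 : MemLp b 2 P := by
    rw [hb]
    exact L.comp_memLp' hνG.memLp_two
  have hν0 : ∫ ω, ν ω ∂P = 0 := by
    ext i
    have := (ContinuousLinearMap.proj (R := ℝ) (φ := fun _ : Fin nx => ℝ) i).integral_comp_comm
      hνG.integrable
    refine this.symm.trans ?_
    rw [hν]
    exact integral_linComb hem hN helaw hNlaw i _ _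
  have hb0 : ∫ ω, b ω ∂P = 0 := by
    rw [hb, L.integral_comp_comm hνG.integrable, hν0, map_zero]
  have hbb : ∀ i j, ∫ ω, b ω i * b ω j ∂P = (W⁻¹ * Matrix.diagonal m * (W⁻¹)ᵀ) i j := by
    intro i j
    rw [hb]
    refine integral_mulVec_mul_mulVec
      (d := fun ω => (EuclideanSpace.equiv (Fin nx) ℝ).symm (ν ω)) ?_ W⁻¹ (Matrix.diagonal m) ?_ i j
    · exact (EuclideanSpace.equiv (Fin nx) ℝ).symm.toContinuousLinearMap.comp_memLp' hνG.memLp_two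
    · intro i j
      rw [hν]
      refine Eq.trans ?_ (integral_linComb_mul_linComb hem hN helaw hNlaw heN i j (m i)
        (-√(m i * (1 - m i))) (m j) (-√(m j * (1 - m j)))).symm
      rw [Matrix.diagonal_apply]
      split_ifs with hij
      · subst hij
        rw [neg_mul_neg, Real.mul_self_sqrt (mul_nonneg (hm i).le (by linarith [hm1 i]))]
        ring
      · rfl
  -- The first bracket is a function of the decoder's data `(u, z)` and the second is independent of
  -- them, so the first is the best estimate and the second its error.
  have hdec : ∀ ω, (ψ (z ω) + L (fun i => s (z ω) i + v ω i - s (z ω) i)) + (r ω + b ω) = x ω := by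
    intro ω
    have h1 : A (y ω - l (z ω)) = L (v ω) + L (ν ω) := by
      rw [← map_add, ← hLW (A (y ω - l (z ω)))]
      congr 1
      ext i
      simp only [hv, hν, he, Pi.add_apply]
      ring
    rw [← hr ω, hb, h1]
    simp only [add_sub_cancel_left]
    abel
  have hrb2 : MemLp (fun ω => r ω + b ω) 2 P := hr2.add hb2
  have hφ2 : MemLp (fun ω => ψ (z ω) + L (fun i => s (z ω) i + v ω i - s (z ω) i)) 2 P := by
    have : (fun ω => ψ (z ω) + L (fun i => s (z ω) i + v ω i - s (z ω) i)) =
        fun ω => x ω - (r ω + b ω) := by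
      ext1 ω
      rw [← hdec ω, add_sub_cancel_right]
    rw [this]
    exact h.memLp_x.sub hrb2
  ext i j
  have hcov := condCov_add_eq_of_indepFun (P := P)
    (w := fun ω => ((fun i => s (z ω) i + v ω i), z ω))
    (φ := fun p : (Fin nx → ℝ) × Vec nz => ψ p.2 + L (fun i => p.1 i - s p.2 i))
    (by fun_prop) (by fun_prop) (by fun_prop) hφ2 hrb2
    (by rw [integral_add (hr2.integrable (by norm_num)) (hb2.integrable (by norm_num)),
      hb0, add_zero]; exact hr0) hind i j
  simp only [hdec] at hcov
  refine hcov.trans ?_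
  rw [integral_add_mul_add_of_indepFun hr2 hb2 hb0 hrb, hbb, ← hW', ← hrr]
  have hdet := (Matrix.isUnit_iff_isUnit_det W).1 hWu
  -- `L ν` has covariance `W⁻¹ diag(m) W⁻ᵀ = D - Σ_{x|yz}`; adding `Cov r = Σ_{x|yz}` gives `D`.
  have : W⁻¹ * (W * (D - condCov P x (fun ω => (y ω, z ω))) * Wᵀ) * (W⁻¹)ᵀ =
      D - condCov P x (fun ω => (y ω, z ω)) := by
    calc _ = (W⁻¹ * W) * (D - condCov P x (fun ω => (y ω, z ω))) * (W⁻¹ * W)ᵀ := by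
          rw [Matrix.transpose_mul]
          simp only [Matrix.mul_assoc]
      _ = _ := by rw [Matrix.nonsing_inv_mul _ hdet, Matrix.transpose_one, Matrix.one_mul,
                    Matrix.mul_one]
  rw [this, Matrix.sub_apply, add_sub_cancel]

lemma exists_auxVar {μ : Measure (Vec nx × Vec ny × Vec nz)} [IsProbabilityMeasure μ]
    (h : IsGaussianRegression μ (fun p => p.1) (fun p => p.2.1) (fun p => p.2.2) A l ψ)
    {D W : Matrix (Fin nx) (Fin nx) ℝ} {m : Fin nx → ℝ} (hm : ∀ i, 0 < m i) (hm1 : ∀ i, m i ≤ 1)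
    (hWu : IsUnit W)
    (hW : W * (condCov μ (fun p => p.1) (fun p => p.2.2) -
        condCov μ (fun p => p.1) (fun p => (p.2.1, p.2.2))) * Wᵀ = 1)
    (hW' : W * (D - condCov μ (fun p => p.1) (fun p => (p.2.1, p.2.2))) * Wᵀ =
      Matrix.diagonal m) :
    ∃ B : RemoteSource.AuxVar μ, B.errorCov = D ∧
      B.rate = ENNReal.ofReal (∑ i, -(Real.log (m i) / 2)) := by
  have hl := h.measurable_l
  let P := μ.prod (Measure.pi fun _ : Fin nx => gaussianReal 0 1)
  have hlaw : P.map (fun p => (p.1.1, p.1.2.1, p.1.2.2)) = μ := by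
    refine Eq.trans Measure.map_fst_prod ?_
    rw [measure_univ, one_smul]
  have hNlaw : P.map (fun p => p.2) = Measure.pi fun _ : Fin nx => gaussianReal 0 1 := by
    refine Eq.trans Measure.map_snd_prod ?_
    rw [measure_univ, one_smul]
  have hNind : IndepFun (fun p => (p.1.1, p.1.2.1, p.1.2.2)) (fun p => p.2) P :=
    indepFun_prod (X := fun p : Vec nx × Vec ny × Vec nz => p) (Y := fun a : Fin nx → ℝ => a)
      measurable_id measurable_id
  have hP := h.of_map_eq (P := P) (x := fun p => p.1.1) (y := fun p => p.1.2.1)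
    (z := fun p => p.1.2.2) (by fun_prop) (by fun_prop) (by fun_prop) hlaw
  have hW1 := hP.integral_mulVec_innov (by fun_prop) (by fun_prop) (by fun_prop) W
  rw [h.condCov_sub_condCov_of_map_eq (by fun_prop) (by fun_prop) (by fun_prop) hlaw, hW] at hW1
  simp only [Matrix.one_apply] at hW1
  obtain ⟨-, -, helaw⟩ := hP.map_mulVec_innov hW1
  have hmA : Measurable fun t : Vec ny => W *ᵥ A t :=
    (measurable_mulVec_ofLp W).comp (g := fun v : Vec nx => W *ᵥ v) (f := fun t => A t)
      (by fun_prop)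
  have hmA' : ∀ i, Measurable fun t : Vec ny => (W *ᵥ A t) i :=
    fun i => (measurable_pi_apply i).comp hmA
  let G : Vec ny × (Fin nx → ℝ) → Fin nx → ℝ := fun q i =>
    (1 - m i) * (W *ᵥ A q.1) i + √(m i * (1 - m i)) * q.2 i
  have hGm : Measurable G := by
    refine measurable_pi_iff.2 fun i => ?_
    have : Measurable fun q : Vec ny × (Fin nx → ℝ) => (W *ᵥ A q.1) i :=
      (hmA' i).comp (f := fun q : Vec ny × (Fin nx → ℝ) => q.1) (by fun_prop)
    simp only [G]
    fun_prop
  -- The encoder sees `y` but not `z`, so it cannot form `y - l z`. It applies the channel to `y`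
  -- itself, which shifts the output by `s z`, a quantity known to the decoder.
  let s : Vec nz → Fin nx → ℝ := fun a i => (1 - m i) * (W *ᵥ A (l a)) i
  have hsm : Measurable s := by
    refine measurable_pi_iff.2 fun i => ?_
    exact ((hmA' i).comp hl).const_mul _
  have hG : ∀ (a : Vec ny) (c : Vec nz) (b : Fin nx → ℝ), G (a, b) = fun i => s c i +
      ((1 - m i) * (W *ᵥ A (a - l c)) i + √(m i * (1 - m i)) * b i) := by
    intro a c b
    ext i
    have h1 : (A (a - l c)).ofLp = (A a).ofLp - (A (l c)).ofLp := by rw [map_sub]; rfl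
    simp only [G, s, h1, Matrix.mulVec_sub, Pi.sub_apply]
    ring
  let B : RemoteSource.AuxVar μ :=
    { Ω := (Vec nx × Vec ny × Vec nz) × (Fin nx → ℝ)
      P := P
      U := Fin nx → ℝ
      x := fun p => p.1.1
      y := fun p => p.1.2.1
      z := fun p => p.1.2.2
      u := fun p => G (p.1.2.1, p.2)
      measurable_x := by fun_prop
      measurable_y := by fun_prop
      measurable_z := by fun_prop
      measurable_u := by fun_prop
      law := hlaw
      markov := condIndepFun_of_indepFun_noise
        (n := fun p : (Vec nx × Vec ny × Vec nz) × (Fin nx → ℝ) => p.2) (by fun_prop) (by fun_prop)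
        (by fun_prop) (hNind.comp (φ := fun p : Vec nx × Vec ny × Vec nz => (p.2.1, (p.1, p.2.2)))
          (by fun_prop) measurable_id) hGm }
  refine ⟨B, ?_, ?_⟩
  · have := hP.condCov_testChannel (N := fun p => p.2) (D := D) (W := W) (by fun_prop) (by fun_prop)
      (by fun_prop) (by fun_prop) hNind hNlaw hsm hm hm1 hWu
      (by rwa [h.condCov_sub_condCov_of_map_eq (by fun_prop) (by fun_prop) (by fun_prop) hlaw])
      (by rwa [h.condCov_prodMk_of_map_eq (by fun_prop) (by fun_prop) (by fun_prop) hlaw])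
    simp only [← hG] at this
    exact this
  · have := condMutualInfo_testChannel (P := P) (N := fun p => p.2) (y := fun p => p.1.2.1)
      (z := fun p => p.1.2.2) (e := fun t => W *ᵥ A t) (by fun_prop) (by fun_prop)
      (by fun_prop) hl hmA hsm hP.indepFun_innov
      (hNind.comp (φ := fun p : Vec nx × Vec ny × Vec nz => (p.2.2, p.2.1 - l p.2.2))
          (by fun_prop) measurable_id) helaw hNlaw hm hm1
    refine Eq.trans (congrArg (fun u => RemoteSource.condMutualInfo P (fun p => p.1.2.1) u
      (fun p => p.1.2.2)) (funext fun p => hG p.1.2.1 p.1.2.2 p.2)) this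

end IsGaussianRegression

/-! ### The main theorem -/

theorem corollary1 {Ω : Type*} [MeasurableSpace Ω] (P : Measure Ω) [IsProbabilityMeasure P]
    {nx ny nz : ℕ}
    (x : Ω → RemoteSource.Vec nx) (y : Ω → RemoteSource.Vec ny) (z : Ω → RemoteSource.Vec nz)
    (hx : Measurable x) (hy : Measurable y) (hz : Measurable z)
    (hG : HasGaussianLaw (fun ω => (x ω, y ω, z ω)) P)
    (Sxz Sxyz D : Matrix (Fin nx) (Fin nx) ℝ)
    (hSxz : Sxz = RemoteSource.condCov P x z)
    (hSxyz : Sxyz = RemoteSource.condCov P x (fun ω => (y ω, z ω)))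
    (hlow : (D - Sxyz).PosDef)
    (hup : (Sxz - D).PosSemidef) :
    -- the rate-distortion function
    RemoteSource.rdf (P.map fun ω => (x ω, y ω, z ω)) D =
        ENNReal.ofReal (1 / 2 * Real.log ((Sxz - Sxyz).det / (D - Sxyz).det)) ∧
    -- the log-determinant formula is a nonnegative real number
    0 ≤ 1 / 2 * Real.log ((Sxz - Sxyz).det / (D - Sxyz).det) ∧
    -- the minimum is attained, with reconstruction error covariance equal to `D`
    (∃ A : RemoteSource.AuxVar (P.map fun ω => (x ω, y ω, z ω)),
        A.errorCov = D ∧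
        A.rate = RemoteSource.rdf (P.map fun ω => (x ω, y ω, z ω)) D) ∧
    -- the lower and the upper bound, which are well defined, coincide with the formula
    (∃ V l l', RemoteSource.IsJointDiagonalization (Sxz - Sxyz) (D - Sxyz) V l l') ∧
    (∀ V l l', RemoteSource.IsJointDiagonalization (Sxz - Sxyz) (D - Sxyz) V l l' →
        RemoteSource.lowerBound l l' =
          1 / 2 * Real.log ((Sxz - Sxyz).det / (D - Sxyz).det) ∧
        RemoteSource.upperBound l l' =
          1 / 2 * Real.log ((Sxz - Sxyz).det / (D - Sxyz).det)) := by
  have hsub : (Sxz - Sxyz) - (D - Sxyz) = Sxz - D := by abel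
  have h₁ : (Sxz - Sxyz).PosDef := by
    rw [← sub_add_sub_cancel Sxz D Sxyz]
    exact hlow.posSemidef_add hup
  have hle : ((Sxz - Sxyz) - (D - Sxyz)).PosSemidef := hsub ▸ hup
  have := hG.isGaussian_map
  obtain ⟨A, l, ψ, hreg⟩ := exists_isGaussianRegression (P.map fun ω => (x ω, y ω, z ω))
  obtain ⟨-, W, -, m, -, -, -, hWu, hW, hW', hm⟩ := exists_whitening h₁ hlow hle
  have hval := log_det_div_det_of_whitening hlow (fun i => (hm i).1) hW hW'
  -- The covariances are moved from `P` to the law of the source, over which auxiliary variables are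
  -- defined.
  rw [hSxz, hSxyz, hreg.condCov_sub_condCov_of_map_eq hx hy hz rfl] at hW
  rw [hSxyz, hreg.condCov_prodMk_of_map_eq hx hy hz rfl] at hW'
  obtain ⟨B, hBcov, hBrate⟩ := hreg.exists_auxVar (fun i => (hm i).1) (fun i => (hm i).2) hWu hW hW'
  have hrdf : RemoteSource.rdf (P.map fun ω => (x ω, y ω, z ω)) D =
      ENNReal.ofReal (1 / 2 * Real.log ((Sxz - Sxyz).det / (D - Sxyz).det)) := by
    rw [hval]
    refine le_antisymm ?_ ?_
    · refine (iInf₂_le B ?_).trans hBrate.le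
      rw [hBcov, sub_self]
      exact Matrix.PosSemidef.zero
    · exact le_iInf₂ fun B hB => hreg.ofReal_le_rate (fun i => (hm i).1) hW hW' B hB
  refine ⟨hrdf, ?_, ⟨B, hBcov, ?_⟩, exists_isJointDiagonalization h₁ hlow hle,
    fun V l l' hV => bounds_eq_of_isJointDiagonalization h₁ hlow hle hV⟩
  · rw [hval]
    refine Finset.sum_nonneg fun i _ => ?_
    have := Real.log_nonpos (hm i).1.le (hm i).2
    linarith
  · rw [hrdf, hBrate, hval]
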